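/- **Setting.** There are $K\ge 1$ users and $N\ge 3$ frames of duration $\Delta$. User $k$ is on the ground at horizontal position $p^m_k\in\mathbb R^2$ and has $I_k\ge 0$ input bits, $C_k>0$ CPU cycles per input bit and $O_k\ge 0$ output bits per input bit. The UAV flies at altitude $H>0$ with horizontal positions $p_1,\dots,p_{N+1}\in\mathbb R^2$ and velocities $v_n=(p_{n+1}-p_n)/\Delta$. Let $\Delta,B,N_0,g_0,\gamma^c,M>0$, $v_{\max}\ge 0$, an energy budget $\mathcal E\in\mathbb R$ and end points $p_I,p_F\in\mathbb R^2$ be given. Put $d_k(p)=\|p-p^m_k\|^2+H^2$, $g_k(p)=g_0/d_k(p)$, $c=N_0B\Delta$, $E_F(v)=\tfrac12M\Delta\|v\|^2$, and, for $l=(l_{k'})_{k'\le K}$, $s(l)=\sum_{k'}C_{k'}l_{k'}$ and $E_k(l)=\frac{\gamma^cC_kl_k}{\Delta^2}s(l)^2$. Put $r_O(L)=2^{L/(B\Delta/K)}-1$ and $r_N(L)=2^{L/(B\Delta)}-1$. The basic variables are the uplink bits $L^m_{k,n}$, the computed bits $l_{k,n+1}$, the downlink bits $L^c_{k,n+2}$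 ($k\le K$, $1\le n\le N-2$) and the positions $p_1,\dots,p_{N+1}$. Let $\mathcal K$ be the convex set defined by: for all $k$ and all $1\le n\le N-2$, $\sum_{i\le n}l_{k,i+1}\le\sum_{i\le n}L^m_{k,i}$ and $\sum_{i\le n}L^c_{k,i+2}\le O_k\sum_{i\le n}l_{k,i+1}$; for all $k$, $\sum_nL^m_{k,n}=\sum_nl_{k,n+1}=I_k$ and $\sum_nL^c_{k,n+2}=O_kI_k$; all bit variables are $\ge 0$; $p_1=p_I$, $p_{N+1}=p_F$; and $\|v_n\|\le v_{\max}$ for $n\le N$. All double sums below are over $k\le K$ and $1\le n\le N-2$. *Problem (O), orthogonal access:* minimize $\sum_{k,n}\frac{c/K}{g_k(p_n)}r_O(L^m_{k,n})$ over $\mathcal K$ subject to $$\sum_{k,n}\Big(E_k(l_{n+1})+\tfrac{c/K}{g_k(p_{n+2})}r_O(L^c_{k,n+2})\Big)+\sum_{n=1}^NE_F(v_n)\le\mathcal E .$$ *Problem (N), non-orthogonal access:* there are additional variables $\alpha_{k,n},\beta_{k,n+2}\ge 0$ ($1\le n\le N-2$); write $A_{k,n}=\sum_{k'\ne k}\alpha_{k',n}$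 and $\mathcal B_{k,n}=\sum_{k'\ne k}\beta_{k',n}$. Minimize $\sum_{k,n}\alpha_{k,n}/g_k(p_n)$ over $\mathcal K\times\{\alpha,\beta\ge0\}$ subject to $\sum_{k,n}(E_k(l_{n+1})+\beta_{k,n+2})+\sum_{n=1}^NE_F(v_n)\le\mathcal E$ and, for all $k$ and $1\le n\le N-2$, $(c+A_{k,n})r_N(L^m_{k,n})\le\alpha_{k,n}$ and $\big(\tfrac{c}{g_k(p_{n+2})}+\mathcal B_{k,n+2}\big)r_N(L^c_{k,n+2})\le\beta_{k,n+2}$. **Inner approximations.** Let a superscript $v$ mark the value at a feasible point $z^v$ and let $\tau_{L_{k,n}},\tau_{\alpha_{k,n}},\tau_{x_n},\tau_{y_n}>0$. With $p=(x,y)$ put $P_n=\frac{\tau_{x_n}}2(x_n-x_n^v)^2+\frac{\tau_{y_n}}2(y_n-y_n^v)^2$. The inner approximation at $z^v$ keeps the set $\mathcal K$ (respectively $\mathcal K\times\{\alpha,\beta\ge 0\}$). In the objective it replaces * each uplink term of (O) by $\frac{c/K}{g_0}\big(r_O(L^m_{k,n})d_k(p_n^v)+r_O(L^{m,v}_{k,n})d_k(p_n)\big)+\frac{\tau_{L_{k,n}}}2(L^m_{k,n}-L^{m,v}_{k,n})^2+P_n$,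 * each term of (N) by $\frac1{g_0}\big(\alpha_{k,n}d_k(p^v_n)+\alpha^v_{k,n}d_k(p_n)\big)+\frac{\tau_{\alpha_{k,n}}}2(\alpha_{k,n}-\alpha_{k,n}^v)^2+P_n$. In the constraints, for a product put $\overline{h_1h_2}=\frac12(h_1+h_2)^2-\frac12\big((h_1^v)^2+(h_2^v)^2\big)-h_1^v\,Dh_1^v[\cdot-\cdot^v]-h_2^v\,Dh_2^v[\cdot-\cdot^v]$, where $Dh^v$ is the derivative at $z^v$, and replace * $E_k(l)$ by $\frac{\gamma^cC_k}{\Delta^2}\overline{h_1h_2}$ with $h_1=l_k$, $h_2=s(l)^2$; * the orthogonal downlink energy by $\frac{c/K}{g_0}\overline{h_1h_2}$ with $h_1=r_O(L^c)$, $h_2=d_k(p)$; * $(c+A)r_N(L^m)$ by $c\,r_N(L^m)+\overline{h_1h_2}$ with $h_1=r_N(L^m)$, $h_2=A$; * $\big(\frac c{g_k(p)}+\mathcal B\big)r_N(L^c)$ by $\frac c{g_0}\overline{h_1h_2}+\overline{h_1h_3}$ with $h_1=r_N(L^c)$, $h_2=d_k(p)$, $h_3=\mathcal B$. **Algorithms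 1 (for (O)) and 2 (for (N)).** Start at a feasible $z(0)$. At step $v$, either stop if $z(v)$ is stationary (then $z(w)=z(v)$ for $w\ge v$), or set $z(v+1)=z(v)+\gamma(v)(\hat z-z(v))$, where $\hat z$ is an optimal solution of the inner approximation at $z(v)$. **Notions.** Write either problem as minimizing $U$ over a convex set $\mathcal C$ subject to $g_j\le 0$, where the $g_j$ are the constraints listed besides membership in $\mathcal K$ (and $\alpha,\beta\ge0$). A feasible $z$ is *stationary* if there are $\mu_j\ge 0$ with $\mu_jg_j(z)=0$ and $\big(\nabla U(z)+\sum_j\mu_j\nabla g_j(z)\big)^T(y-z)\ge0$ for all $y\in\mathcal C$. It is *regular* (Mangasarian–Fromovitz) if some $y\in\mathcal C$ satisfies $\nabla g_j(z)^T(y-z)<0$ for every $j$ with $g_j(z)=0$. **Claim.** Let $\gamma(v)\in(0,1]$, $\gamma(v)\to0$ and $\sum_v\gamma(v)=\infty$. For Algorithm 1 and problem (O), and likewise for Algorithm 2 and problem (N): the inner approximation at every feasible point has an optimal solution; and for every run (with any choice of the optimal solutions $\hat z$) all iterates are feasible, the sequence $\{z(v)\}$ is bounded, and every regular limit point of it is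 a stationary solution of the original problem. Furthermore, if no iterate $z(v)$ is stationary (the algorithm does not stop), then no regular limit point is a local maximum of the original problem (of $U$ over its feasible set). -/

import Mathlib

open Filter Topology

namespace UAV

noncomputable section

/-! ## Smooth constrained programs, stationarity, and the successive convex approximation scheme -/

/-- The program `minimize obj z` subject to `z ∈ carrier` and `con j z ≤ 0` for all `j`.
The set `carrier` collects the convex constraints, the functions `con j` the remaining ones. -/
structure Program (E J : Type*) where
  carrier : Set E
  obj : E → ℝ
  con : J → E → ℝ

namespace Program

variable {E J : Type*}

/-- The feasible set. -/
def feasible (P : Program E J) : Set E :=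
  {z | z ∈ P.carrier ∧ ∀ j, P.con j z ≤ 0}

/-- `z` is an optimal solution (global minimizer over the feasible set). -/
def IsSolution (P : Program E J) (z : E) : Prop :=
  z ∈ P.feasible ∧ IsMinOn P.obj P.feasible z

variable [NormedAddCommGroup E] [NormedSpace ℝ E]

/-- Stationary (KKT) points: `-∇obj z - ∑ j, μ j ∇(con j) z` lies in the normal cone of the convex
set `carrier` at `z`, for multipliers `μ ≥ 0` satisfying complementary slackness. -/
def IsStationary [Fintype J] (P : Program E J) (z : E) : Prop :=
  z ∈ P.feasible ∧ ∃ μ : J → ℝ, (∀ j, 0 ≤ μ j) ∧ (∀ j, μ j * P.con j z = 0) ∧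
    ∀ y ∈ P.carrier,
      0 ≤ fderiv ℝ P.obj z (y - z) + ∑ j, μ j * fderiv ℝ (P.con j) z (y - z)

/-- Regular points: the Mangasarian-Fromovitz constraint qualification relative to the convex set
`carrier`, i.e. some direction pointing into `carrier` strictly decreases, to first order, all the
active constraints. -/
def IsRegular (P : Program E J) (z : E) : Prop :=
  ∃ y ∈ P.carrier, ∀ j, P.con j z = 0 → fderiv ℝ (P.con j) z (y - z) < 0

/-- `z 0, z 1, …` is produced by the successive convex approximation algorithm for `P` with inner
approximations `approx y` (around `y`) and step sizes `γ`. It starts at a feasible point. At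
iteration `v` it moves from `z v` by the fraction `γ v` towards an optimal solution of
`approx (z v)`, or it stops because `z v` is stationary, and then the sequence stays at `z v`. -/
def IsSCARun [Fintype J] (P : Program E J) (approx : E → Program E J) (γ : ℕ → ℝ) (z : ℕ → E) :
    Prop :=
  z 0 ∈ P.feasible ∧
    ∀ v, (∃ zhat, (approx (z v)).IsSolution zhat ∧ z (v + 1) = z v + γ v • (zhat - z v)) ∨
      (P.IsStationary (z v) ∧ ∀ w, v ≤ w → z w = z v)

end Program

/-! ## System model -/

/-- The horizontal plane with its Euclidean norm. -/
abbrev Plane := EuclideanSpace ℝ (Fin 2)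

/-- The data of the system with `K` mobile users. -/
structure Params (K : ℕ) where
  /-- number of input bits of each user -/
  I : Fin K → ℝ
  /-- CPU cycles per input bit -/
  C : Fin K → ℝ
  /-- output bits per input bit -/
  O : Fin K → ℝ
  /-- horizontal positions of the users, who are on the ground -/
  pos : Fin K → Plane
  /-- altitude of the UAV -/
  H : ℝ
  /-- received power at reference distance -/
  g₀ : ℝ
  /-- noise spectral density -/
  N₀ : ℝ
  /-- bandwidth -/
  B : ℝ
  /-- frame duration -/
  Δ : ℝ
  /-- effective switched capacitance of the cloudlet processor -/
  γc : ℝ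
  /-- mass of the UAV -/
  mass : ℝ
  /-- maximum speed -/
  vmax : ℝ
  /-- initial horizontal position -/
  pI : Plane
  /-- final horizontal position -/
  pF : Plane
  /-- energy budget of the UAV -/
  budget : ℝ
  I_nonneg : ∀ k, 0 ≤ I k
  C_pos : ∀ k, 0 < C k
  O_nonneg : ∀ k, 0 ≤ O k
  H_pos : 0 < H
  g₀_pos : 0 < g₀
  N₀_pos : 0 < N₀
  B_pos : 0 < B
  Δ_pos : 0 < Δ
  γc_pos : 0 < γc
  mass_pos : 0 < mass
  vmax_nonneg : 0 ≤ vmax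

namespace Params

variable {K : ℕ} (S : Params K)

/-- Squared distance between user `k` and the UAV at horizontal position `p`. -/
def distSq (k : Fin K) (p : Plane) : ℝ :=
  (p 0 - S.pos k 0) ^ 2 + (p 1 - S.pos k 1) ^ 2 + S.H ^ 2

/-- Channel gain. -/
def gain (k : Fin K) (p : Plane) : ℝ := S.g₀ / S.distSq k p

/-- Computation energy at the cloudlet for user `k` in a frame in which `l k'` bits of each user
`k'` are computed. -/
def compEnergy (k : Fin K) (l : Fin K → ℝ) : ℝ :=
  S.γc * S.C k * l k / S.Δ ^ 2 * (∑ k', S.C k' * l k') ^ 2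

/-- `2 ^ (L / (B Δ / K)) - 1`, orthogonal access. -/
def oRate (L : ℝ) : ℝ := (2 : ℝ) ^ (L / (S.B * S.Δ / K)) - 1

/-- `2 ^ (L / (B Δ)) - 1`, non-orthogonal access. -/
def nRate (L : ℝ) : ℝ := (2 : ℝ) ^ (L / (S.B * S.Δ)) - 1

/-- Energy for transmitting `L` bits between user `k` and the UAV at `p`, orthogonal access. -/
def oEnergy (k : Fin K) (L : ℝ) (p : Plane) : ℝ :=
  S.N₀ * S.B * S.Δ / K / S.gain k p * S.oRate L

/-- Flying energy per frame at velocity `v`. -/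
def flyEnergy (v : Plane) : ℝ := 1 / 2 * S.mass * S.Δ * ‖v‖ ^ 2

/-- Uplink energy of user `k`, non-orthogonal access, given the received energies `α k'` of the
other users. -/
def nUpEnergy (k : Fin K) (L : ℝ) (p : Plane) (α : Fin K → ℝ) : ℝ :=
  1 / S.gain k p * (S.N₀ * S.B * S.Δ + ∑ k' ∈ Finset.univ.erase k, α k') * S.nRate L

/-- Downlink energy for user `k`, non-orthogonal access, given the downlink energies `β k'` of the
other users. -/
def nDownEnergy (k : Fin K) (L : ℝ) (p : Plane) (β : Fin K → ℝ) : ℝ :=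
  (S.N₀ * S.B * S.Δ / S.gain k p + ∑ k' ∈ Finset.univ.erase k, β k') * S.nRate L

/-! ### Surrogates. Arguments with suffix `v` are the current iterate. -/

/-- Surrogate of the orthogonal uplink energy: partial linearization of a product of two convex
functions plus proximal terms. -/
def oUpSurr (k : Fin K) (τL τx τy : ℝ) (L : ℝ) (p : Plane) (Lv : ℝ) (pv : Plane) : ℝ :=
  S.N₀ * S.B * S.Δ / K / S.g₀ * S.oRate L * S.distSq k pv
    + S.N₀ * S.B * S.Δ / K / S.g₀ * S.oRate Lv * S.distSq k p
    + τL / 2 * (L - Lv) ^ 2 + τx / 2 * (p 0 - pv 0) ^ 2 + τy / 2 * (p 1 - pv 1) ^ 2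

/-- Convex upper bound of the computation energy. -/
def compSurr (k : Fin K) (l lv : Fin K → ℝ) : ℝ :=
  S.γc * S.C k / (2 * S.Δ ^ 2) *
      ((l k + (∑ k', S.C k' * l k') ^ 2) ^ 2 - lv k ^ 2 - (∑ k', S.C k' * lv k') ^ 4)
    - S.γc * S.C k / S.Δ ^ 2 *
      (lv k * (l k - lv k)
        + 2 * (∑ k', S.C k' * lv k') ^ 3 * ∑ k', S.C k' * (l k' - lv k'))

/-- Convex upper bound of the orthogonal downlink energy. -/
def oDownSurr (k : Fin K) (L : ℝ) (p : Plane) (Lv : ℝ) (pv : Plane) : ℝ :=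
  S.N₀ * S.B * S.Δ / K / (2 * S.g₀) *
      ((S.oRate L + S.distSq k p) ^ 2 - S.oRate Lv ^ 2 - S.distSq k pv ^ 2)
    - S.N₀ * Real.log 2 / S.g₀ * (2 : ℝ) ^ (Lv / (S.B * S.Δ / K)) * S.oRate Lv * (L - Lv)
    - 2 * S.N₀ * S.B * S.Δ / K / S.g₀ * S.distSq k pv *
      ((pv 0 - S.pos k 0) * (p 0 - pv 0) + (pv 1 - S.pos k 1) * (p 1 - pv 1))

/-- Surrogate of `α / gain`. -/
def nObjSurr (k : Fin K) (τα τx τy : ℝ) (α : ℝ) (p : Plane) (αv : ℝ) (pv : Plane) : ℝ :=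
  α / S.g₀ * S.distSq k pv + αv / S.g₀ * S.distSq k p
    + τα / 2 * (α - αv) ^ 2 + τx / 2 * (p 0 - pv 0) ^ 2 + τy / 2 * (p 1 - pv 1) ^ 2

/-- Convex upper bound of `gain * nUpEnergy`. -/
def nUpSurr (k : Fin K) (L : ℝ) (α : Fin K → ℝ) (Lv : ℝ) (αv : Fin K → ℝ) : ℝ :=
  S.N₀ * S.B * S.Δ * S.nRate L
    + 1 / 2 * ((S.nRate L + ∑ k' ∈ Finset.univ.erase k, α k') ^ 2 - S.nRate Lv ^ 2
        - (∑ k' ∈ Finset.univ.erase k, αv k') ^ 2)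
    - Real.log 2 / (S.B * S.Δ) * (2 : ℝ) ^ (Lv / (S.B * S.Δ)) * S.nRate Lv * (L - Lv)
    - (∑ k' ∈ Finset.univ.erase k, αv k') * ∑ k' ∈ Finset.univ.erase k, (α k' - αv k')

/-- Convex upper bound of `nDownEnergy`. -/
def nDownSurr (k : Fin K) (L : ℝ) (p : Plane) (β : Fin K → ℝ) (Lv : ℝ) (pv : Plane)
    (βv : Fin K → ℝ) : ℝ :=
  1 / 2 * (S.N₀ * S.B * S.Δ / S.g₀ * (S.nRate L + S.distSq k p) ^ 2
      + (S.nRate L + ∑ k' ∈ Finset.univ.erase k, β k') ^ 2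
      - (S.N₀ * S.B * S.Δ / S.g₀ + 1) * S.nRate Lv ^ 2
      - (∑ k' ∈ Finset.univ.erase k, βv k') ^ 2
      - S.N₀ * S.B * S.Δ / S.g₀ * S.distSq k pv ^ 2)
    - Real.log 2 * (S.N₀ / S.g₀ + 1 / (S.B * S.Δ)) * (2 : ℝ) ^ (Lv / (S.B * S.Δ)) * S.nRate Lv
        * (L - Lv)
    - (∑ k' ∈ Finset.univ.erase k, βv k') * ∑ k' ∈ Finset.univ.erase k, (β k' - βv k')
    - 2 * S.N₀ * S.B * S.Δ / S.g₀ * S.distSq k pv *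
      ((pv 0 - S.pos k 0) * (p 0 - pv 0) + (pv 1 - S.pos k 1) * (p 1 - pv 1))

end Params

/-! ## Optimization variables

With frames numbered `1, …, N`, the index `i : Fin (N - 2)` stands for the round `n = i + 1`: uplink
bits are sent in frame `n`, computed bits are processed in frame `n + 1`, and downlink bits are sent
in frame `n + 2`. The position index `j : Fin (N + 1)` stands for `n = j + 1`. -/

/-- A family of real variables indexed by users and rounds. -/
abbrev Alloc (K N : ℕ) := Fin K → Fin (N - 2) → ℝ

/-- Variables for orthogonal access: uplink bits, computed bits, downlink bits, trajectory. -/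
abbrev OVar (K N : ℕ) := Alloc K N × Alloc K N × Alloc K N × (Fin (N + 1) → Plane)

/-- Variables for non-orthogonal access: those above and the slacks `α`, `β`. The entry `β k i` is
the slack of frame `n + 2`. -/
abbrev NVar (K N : ℕ) := OVar K N × Alloc K N × Alloc K N

namespace OVar

variable {K N : ℕ} (z : OVar K N)

/-- Uplink bits. -/
abbrev up : Alloc K N := z.1

/-- Computed bits. -/
abbrev comp : Alloc K N := z.2.1

/-- Downlink bits. -/
abbrev down : Alloc K N := z.2.2.1

/-- Trajectory. -/
abbrev path : Fin (N + 1) → Plane := z.2.2.2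

/-- UAV position during the uplink frame of round `i`. -/
def pUp (i : Fin (N - 2)) : Plane := z.path ⟨i.1, by omega⟩

/-- UAV position during the downlink frame of round `i`. -/
def pDown (i : Fin (N - 2)) : Plane := z.path ⟨i.1 + 2, by omega⟩

end OVar

section Problems

variable {K N : ℕ} (S : Params K)

/-- Velocity in each frame. -/
def velocity (z : OVar K N) (n : Fin N) : Plane :=
  (1 / S.Δ) • (z.path n.succ - z.path n.castSucc)

/-- Total flying energy. -/
def totalFly (z : OVar K N) : ℝ := ∑ n : Fin N, S.flyEnergy (velocity S z n)

/-- The convex constraints common to both access schemes: causality of computing and of the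
downlink, completion of the offloading, non-negativity, end points and maximum speed. -/
def schedules (N : ℕ) : Set (OVar K N) :=
  {z | (∀ k n, ∑ i ∈ Finset.Iic n, z.comp k i ≤ ∑ i ∈ Finset.Iic n, z.up k i) ∧
    (∀ k n, ∑ i ∈ Finset.Iic n, z.down k i ≤ S.O k * ∑ i ∈ Finset.Iic n, z.comp k i) ∧
    (∀ k, ∑ i, z.up k i = S.I k) ∧
    (∀ k, ∑ i, z.comp k i = S.I k) ∧
    (∀ k, ∑ i, z.down k i = S.O k * S.I k) ∧
    (∀ k i, 0 ≤ z.up k i ∧ 0 ≤ z.comp k i ∧ 0 ≤ z.down k i) ∧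
    z.path 0 = S.pI ∧ z.path (Fin.last N) = S.pF ∧
    ∀ n, ‖velocity S z n‖ ≤ S.vmax}

/-- The non-convex design problem for orthogonal access; its only non-convex constraint is the UAV
energy budget. -/
def orthProblem (N : ℕ) : Program (OVar K N) Unit where
  carrier := schedules S N
  obj z := ∑ k, ∑ i, S.oEnergy k (z.up k i) (z.pUp i)
  con _ z :=
    (∑ k, ∑ i, (S.compEnergy k (fun k' => z.comp k' i) + S.oEnergy k (z.down k i) (z.pDown i)))
      + totalFly S z - S.budget

/-- The convex inner approximation of `orthProblem` around `zv`. -/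
def orthApprox (τL : Alloc K N) (τx τy : Fin (N - 2) → ℝ) (zv : OVar K N) :
    Program (OVar K N) Unit where
  carrier := schedules S N
  obj z := ∑ k, ∑ i,
    S.oUpSurr k (τL k i) (τx i) (τy i) (z.up k i) (z.pUp i) (zv.up k i) (zv.pUp i)
  con _ z :=
    (∑ k, ∑ i, (S.compSurr k (fun k' => z.comp k' i) (fun k' => zv.comp k' i)
        + S.oDownSurr k (z.down k i) (z.pDown i) (zv.down k i) (zv.pDown i)))
      + totalFly S z - S.budget

/-- The convex constraints for non-orthogonal access. -/
def slackSchedules (N : ℕ) : Set (NVar K N) :=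
  {z | z.1 ∈ schedules S N ∧ ∀ k i, 0 ≤ z.2.1 k i ∧ 0 ≤ z.2.2 k i}

/-- Index of the non-convex constraints for non-orthogonal access: the energy budget, and one
uplink and one downlink constraint per user and round. -/
abbrev NCon (K N : ℕ) := Unit ⊕ (Fin K × Fin (N - 2)) ⊕ (Fin K × Fin (N - 2))

/-- The non-convex design problem for non-orthogonal access in slack form. -/
def nomaProblem (N : ℕ) : Program (NVar K N) (NCon K N) where
  carrier := slackSchedules S N
  obj z := ∑ k, ∑ i, z.2.1 k i / S.gain k (z.1.pUp i)
  con
    | .inl _ => fun z =>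
      (∑ k, ∑ i, (S.compEnergy k (fun k' => z.1.comp k' i) + z.2.2 k i))
        + totalFly S z.1 - S.budget
    | .inr (.inl (k, i)) => fun z =>
      S.gain k (z.1.pUp i) * S.nUpEnergy k (z.1.up k i) (z.1.pUp i) (fun k' => z.2.1 k' i)
        - z.2.1 k i
    | .inr (.inr (k, i)) => fun z =>
      S.nDownEnergy k (z.1.down k i) (z.1.pDown i) (fun k' => z.2.2 k' i) - z.2.2 k i

/-- The convex inner approximation of `nomaProblem` around `zv`. -/
def nomaApprox (τα : Alloc K N) (τx τy : Fin (N - 2) → ℝ) (zv : NVar K N) :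
    Program (NVar K N) (NCon K N) where
  carrier := slackSchedules S N
  obj z := ∑ k, ∑ i,
    S.nObjSurr k (τα k i) (τx i) (τy i) (z.2.1 k i) (z.1.pUp i) (zv.2.1 k i) (zv.1.pUp i)
  con
    | .inl _ => fun z =>
      (∑ k, ∑ i, (S.compSurr k (fun k' => z.1.comp k' i) (fun k' => zv.1.comp k' i) + z.2.2 k i))
        + totalFly S z.1 - S.budget
    | .inr (.inl (k, i)) => fun z =>
      S.nUpSurr k (z.1.up k i) (fun k' => z.2.1 k' i) (zv.1.up k i) (fun k' => zv.2.1 k' i)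
        - z.2.1 k i
    | .inr (.inr (k, i)) => fun z =>
      S.nDownSurr k (z.1.down k i) (z.1.pDown i) (fun k' => z.2.2 k' i)
          (zv.1.down k i) (zv.1.pDown i) (fun k' => zv.2.2 k' i)
        - z.2.2 k i

end Problems

end

end UAV

/-! The convergence argument is abstract: it uses only the properties collected in `IsInnerApprox`,
and the two access schemes enter through their verification.

At a regular feasible point that is not stationary, separating the linearized problem from the open
negative orthant yields a direction that lowers the objective and every active constraint to first
order (`exists_descent_direction`). The surrogates agree with the originals to first order, so a
short move in that direction is strictly feasible for the inner approximation and lowers the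
surrogate objective. Strict inequalities survive small perturbations. Hence the best surrogate
decrease is at least some δ > 0 at all nearby base points (`exists_gap`). Neither uniqueness nor
continuity of the surrogate solution is needed.

Iterates stay feasible because the surrogate constraints are convex majorants. A product is
½(h₁+h₂)² − ½h₁² − ½h₂², and replacing the last two terms by tangent bounds gives such a majorant
(`mul_le_half_sq`). The surrogate objective is not a majorant. Instead, the proximal terms absorb
the second-order cross term of the product once γ(v) is small (`product_step_le`), so U eventually
drops by at least γ(v) times the surrogate decrease. This makes U bounded along the run, and hence
the run itself.

Near a regular nonstationary limit point, every step lowers U by at least δγ(v) and moves by at most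
a constant times γ(v), so the distance travelled is controlled by the drop of U. Started close
enough to the limit, with U almost at its limiting value, the run cannot leave the neighbourhood;
then Σγ(v) = ∞ contradicts U ≥ 0.

If a regular limit point were a local maximum, a late iterate close to it would have U no larger
than at the limit, while its successor has U no smaller. Its surrogate decrease would be zero, and,
regularity being open, it would itself be stationary. -/

namespace UAV.Program

/-! ## Convergence of successive convex approximation -/

variable {E J : Type*} [NormedAddCommGroup E] [NormedSpace ℝ E]

/-- At a regular feasible point that is not stationary, some direction into the carrier decreases
the objective and all active constraints to first order. -/
theorem exists_descent_direction [Fintype J] {P : Program E J} (hP : Convex ℝ P.carrier) {z : E}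
    (hz : z ∈ P.feasible) (hreg : P.IsRegular z) (hns : ¬ P.IsStationary z) :
    ∃ y ∈ P.carrier, fderiv ℝ P.obj z (y - z) < 0 ∧
      ∀ j, P.con j z = 0 → fderiv ℝ (P.con j) z (y - z) < 0 := by
  classical
  by_contra! hcon
  apply hns
  -- Adding the value `P.con j z` makes the map affine in `y` and lets inactive constraints be
  -- treated together with active ones; complementary slackness then comes out of the separation
  -- itself.
  let D : E → Option J → ℝ := fun y o =>
    o.elim (fderiv ℝ P.obj z (y - z)) fun j => P.con j z + fderiv ℝ (P.con j) z (y - z)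
  have hDconv : Convex ℝ (D '' P.carrier) := by
    rintro _ ⟨x, hx, rfl⟩ _ ⟨y, hy, rfl⟩ a b ha hb hab
    refine ⟨a • x + b • y, hP hx hy ha hb hab, ?_⟩
    have hxy : a • x + b • y - z = a • (x - z) + b • (y - z) := by
      have : z = a • z + b • z := by rw [← add_smul, hab, one_smul]
      nth_rewrite 1 [this]
      simp only [smul_sub]
      abel
    funext o
    cases o with
    | none =>
      simp only [D, Option.elim, hxy, map_add, map_smul, smul_eq_mul, Pi.add_apply, Pi.smul_apply]
    | some j =>
      have : P.con j z = a * P.con j z + b * P.con j z := by rw [← add_mul, hab, one_mul]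
      simp only [D, Option.elim, hxy, map_add, map_smul, smul_eq_mul, Pi.add_apply, Pi.smul_apply]
      linear_combination this
  let Neg : Set (Option J → ℝ) := {w | ∀ o, w o < 0}
  have hNconv : Convex ℝ Neg := by
    have : Neg = Set.univ.pi fun _ => Set.Iio (0 : ℝ) := by ext; simp [Neg]
    rw [this]
    exact convex_pi fun _ _ => convex_Iio 0
  have hNopen : IsOpen Neg := by
    have : Neg = Set.univ.pi fun _ => Set.Iio (0 : ℝ) := by ext; simp [Neg]
    rw [this]
    exact isOpen_set_pi Set.finite_univ fun _ _ => isOpen_Iio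
  have hdisj : Disjoint Neg (D '' P.carrier) := by
    rw [Set.disjoint_left]
    rintro _ hw ⟨y, hy, rfl⟩
    obtain ⟨j, hj, hj'⟩ := hcon y hy (hw none)
    have := hw (some j)
    simp only [D, Option.elim, hj, zero_add] at this
    linarith
  obtain ⟨f, u, hfN, hfD⟩ := geometric_hahn_banach_open hNconv hNopen hDconv hdisj
  let m : Option J → ℝ := fun o => f (Pi.single o 1)
  have hf : ∀ w, f w = ∑ o, w o * m o := by
    intro w
    conv_lhs => rw [pi_eq_sum_univ' w]
    rw [map_sum]
    refine Finset.sum_congr rfl fun o _ => ?_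
    rw [map_smul, smul_eq_mul]
  -- A negative weight would let `f` exceed `u` on the orthant: `T` is tuned so that the value at
  -- the test point is `|u| + |s| - s`, which is at least `u`.
  have hm : ∀ o, 0 ≤ m o := by
    intro o
    by_contra! ho
    let s := ∑ o, m o
    let T := (|u| + |s|) / (-m o)
    have hT : 0 ≤ T := div_nonneg (by positivity) (by linarith)
    have h1 := hfN (fun o' => -1 - if o' = o then T else 0) (by
      intro o'
      dsimp only
      split_ifs <;> linarith)
    rw [hf] at h1
    have h2 : ∑ o', (-1 - if o' = o then T else 0) * m o' = -s - T * m o := by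
      simp [sub_mul, Finset.sum_sub_distrib, s]
    have h3 : T * m o = -(|u| + |s|) := by
      have := ho.ne
      simp only [T, div_neg, neg_mul]
      rw [div_mul_cancel₀ _ this]
    rw [h2, h3] at h1
    linarith [le_abs_self u, le_abs_self s]
  -- The origin lies on the boundary of the orthant. For negative `u` the constant vector `u / (s +
  -- 1)` is already close enough to it to violate the separation.
  have hu0 : 0 ≤ u := by
    by_contra! hu
    let s := ∑ o, m o
    have hs : 0 ≤ s := Finset.sum_nonneg fun o _ => hm o
    have h1 := hfN (fun _ => u / (s + 1)) (fun _ => div_neg_of_neg_of_pos hu (by linarith))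
    rw [hf, ← Finset.mul_sum] at h1
    have h2 : u / (s + 1) * (s + 1) = u := by field_simp
    have h3 : u / (s + 1) < 0 := div_neg_of_neg_of_pos hu (by linarith)
    change u / (s + 1) * s < u at h1
    linarith
  -- At `y = z` only the constraint values remain; their weighted sum is both nonnegative and a sum
  -- of nonpositive terms, so each term vanishes.
  have hDz := hfD _ ⟨z, hz.1, rfl⟩
  rw [hf, Fintype.sum_option] at hDz
  simp only [D, Option.elim, sub_self, map_zero, zero_mul, zero_add, add_zero] at hDz
  have hterm : ∀ j ∈ Finset.univ, P.con j z * m (some j) ≤ 0 := fun j _ =>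
    mul_nonpos_of_nonpos_of_nonneg (hz.2 j) (hm _)
  have hslack : ∀ j, P.con j z * m (some j) = 0 := fun j =>
    (Finset.sum_eq_zero_iff_of_nonpos hterm).1
      (le_antisymm (Finset.sum_nonpos hterm) (hu0.trans hDz)) j (Finset.mem_univ j)
  have hmain : ∀ y ∈ P.carrier, 0 ≤ m none * fderiv ℝ P.obj z (y - z) +
      ∑ j, m (some j) * fderiv ℝ (P.con j) z (y - z) := by
    intro y hy
    have h1 := hu0.trans (hfD _ ⟨y, hy, rfl⟩)
    rw [hf, Fintype.sum_option] at h1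
    simp only [D, Option.elim, add_mul, hslack, zero_add] at h1
    simpa only [mul_comm] using h1
  -- This is where regularity enters: with zero weight on the objective, the Mangasarian–Fromovitz
  -- direction forces all other weights to vanish, and `f = 0` cannot separate strictly.
  have hm0 : 0 < m none := by
    refine lt_of_le_of_ne (hm none) fun h0 => ?_
    obtain ⟨y, hy, hyj⟩ := hreg
    have h1 := hmain y hy
    rw [← h0, zero_mul, zero_add] at h1
    have h2 : ∀ j ∈ Finset.univ, m (some j) * fderiv ℝ (P.con j) z (y - z) ≤ 0 := by
      intro j _
      rcases mul_eq_zero.1 (hslack j) with h | h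
      · exact mul_nonpos_of_nonneg_of_nonpos (hm _) (hyj j h).le
      · simp [h]
    have h3 := (Finset.sum_eq_zero_iff_of_nonpos h2).1 (le_antisymm (Finset.sum_nonpos h2) h1)
    have h4 : ∀ j, m (some j) = 0 := by
      intro j
      rcases mul_eq_zero.1 (hslack j) with h | h
      · exact (mul_eq_zero.1 (h3 j (Finset.mem_univ j))).resolve_right (hyj j h).ne
      · exact h
    have h5 := hfN (fun _ => -1) (fun _ => by norm_num)
    rw [hf, Fintype.sum_option] at h5
    simp only [← h0, h4, mul_zero, Finset.sum_const_zero, add_zero] at h5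
    have h6 : u ≤ 0 := by simpa [h4] using hDz
    linarith
  refine ⟨hz, fun j => m (some j) / m none, fun j => div_nonneg (hm _) hm0.le, fun j => ?_,
    fun y hy => ?_⟩
  · rw [div_mul_eq_mul_div, mul_comm, hslack, zero_div]
  · have h1 := div_nonneg (hmain y hy) hm0.le
    rw [add_div, mul_div_cancel_left₀ _ hm0.ne', Finset.sum_div] at h1
    refine h1.trans_eq (congrArg _ (Finset.sum_congr rfl fun j _ => by ring))

/-- A function with negative derivative in direction `d` drops along `d` for small steps. -/
theorem eventually_lt_of_fderiv_neg {f : E → ℝ} {f' : E →L[ℝ] ℝ} {z d : E}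
    (hf : HasFDerivAt f f' z) (hd : f' d < 0) : ∀ᶠ t in 𝓝[>] (0 : ℝ), f (z + t • d) < f z := by
  have h := (hf.hasLineDerivAt d).tendsto_slope_zero_right
  filter_upwards [h.eventually_lt_const hd, self_mem_nhdsWithin] with t ht ht0
  rw [smul_eq_mul] at ht
  have h0 : (0 : ℝ) < t := ht0
  have := (inv_mul_lt_iff₀ h0).1 ht
  linarith

/-- Inner approximations `A y` of `P` around its feasible points `y`: they have the same carrier,
convex constraints that majorize those of `P`, agree with `P` to first order at `y`, depend
smoothly on `y` and the variable, and a decrease of the surrogate objective is inherited by the objective of `P`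
for short steps. -/
structure IsInnerApprox (P : Program E J) (A : E → Program E J) : Prop where
  convex_carrier : Convex ℝ P.carrier
  isClosed_carrier : IsClosed P.carrier
  carrier_eq : ∀ y, (A y).carrier = P.carrier
  contDiff_obj : ContDiff ℝ 1 P.obj
  contDiff_con : ∀ j, ContDiff ℝ 1 (P.con j)
  contDiff_approx_obj : ContDiff ℝ 1 fun q : E × E => (A q.1).obj q.2
  contDiff_approx_con : ∀ j, ContDiff ℝ 1 fun q : E × E => (A q.1).con j q.2
  convex_con : ∀ y ∈ P.feasible, ∀ j, ConvexOn ℝ P.carrier ((A y).con j)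
  con_self : ∀ y j, (A y).con j y = P.con j y
  con_le : ∀ y ∈ P.feasible, ∀ j x, P.con j x ≤ (A y).con j x
  hasFDerivAt_obj : ∀ y, HasFDerivAt (A y).obj (fderiv ℝ P.obj y) y
  obj_nonneg : ∀ y ∈ P.feasible, 0 ≤ P.obj y
  -- `C` is uniform in the base point, so vanishing step sizes eventually meet the condition without
  -- a line search. Writing it as `t * C ≤ 1` avoids requiring `C` to be positive.
  descent : ∃ C : ℝ, ∀ y ∈ P.feasible, ∀ x ∈ P.carrier, ∀ t : ℝ, 0 ≤ t → t ≤ 1 → t * C ≤ 1 →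
    P.obj (y + t • (x - y)) ≤ P.obj y + t * ((A y).obj x - (A y).obj y)
  bounded : ∀ R : ℝ, ∃ D : ℝ, ∀ y ∈ P.feasible, P.obj y ≤ R → ∀ x ∈ (A y).feasible,
    (A y).obj x ≤ (A y).obj y → ‖x‖ ≤ D

namespace IsInnerApprox

variable {P : Program E J} {A : E → Program E J}

/-! ### Properties of a single inner approximation -/

theorem continuous_obj (h : IsInnerApprox P A) (y : E) : Continuous (A y).obj :=
  h.contDiff_approx_obj.continuous.comp (Continuous.prodMk_right y)

theorem continuous_con (h : IsInnerApprox P A) (y : E) (j : J) : Continuous ((A y).con j) :=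
  (h.contDiff_approx_con j).continuous.comp (Continuous.prodMk_right y)

theorem continuous_obj_left (h : IsInnerApprox P A) (x : E) : Continuous fun y => (A y).obj x :=
  h.contDiff_approx_obj.continuous.comp (Continuous.prodMk_left x)

theorem continuous_con_left (h : IsInnerApprox P A) (j : J) (x : E) :
    Continuous fun y => (A y).con j x :=
  (h.contDiff_approx_con j).continuous.comp (Continuous.prodMk_left x)

theorem continuous_obj_diag (h : IsInnerApprox P A) : Continuous fun y => (A y).obj y :=
  h.contDiff_approx_obj.continuous.comp (continuous_id.prodMk continuous_id)

theorem differentiable_con (h : IsInnerApprox P A) (y : E) (j : J) :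
    Differentiable ℝ ((A y).con j) :=
  ((h.contDiff_approx_con j).comp (contDiff_prodMk_right y)).differentiable one_ne_zero

theorem isClosed_feasible (h : IsInnerApprox P A) : IsClosed P.feasible := by
  have : P.feasible = P.carrier ∩ ⋂ j, {z | P.con j z ≤ 0} := by
    ext; simp [feasible]
  rw [this]
  exact h.isClosed_carrier.inter (isClosed_iInter fun j =>
    isClosed_le (h.contDiff_con j).continuous continuous_const)

theorem isClosed_feasible_approx (h : IsInnerApprox P A) (y : E) : IsClosed (A y).feasible := by
  have : (A y).feasible = P.carrier ∩ ⋂ j, {z | (A y).con j z ≤ 0} := by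
    ext; simp [feasible, h.carrier_eq]
  rw [this]
  exact h.isClosed_carrier.inter (isClosed_iInter fun j =>
    isClosed_le (h.continuous_con y j) continuous_const)

theorem self_mem_feasible (h : IsInnerApprox P A) {y : E} (hy : y ∈ P.feasible) :
    y ∈ (A y).feasible :=
  ⟨by rw [h.carrier_eq]; exact hy.1, fun j => by rw [h.con_self]; exact hy.2 j⟩

/-- The gap between surrogate and constraint is nonnegative and vanishes at `y`, hence has a minimum
there. Gradient consistency is thus a consequence of majorization and needs no computation. -/
theorem hasFDerivAt_con (h : IsInnerApprox P A) {y : E} (hy : y ∈ P.feasible) (j : J) :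
    HasFDerivAt ((A y).con j) (fderiv ℝ (P.con j) y) y := by
  have h1 := (h.differentiable_con y j y).hasFDerivAt
  have h2 := ((h.contDiff_con j).differentiable one_ne_zero y).hasFDerivAt
  have hmin : IsLocalMin (fun x => (A y).con j x - P.con j x) y := by
    refine Filter.Eventually.of_forall fun x => ?_
    simp only [h.con_self, sub_self]
    exact sub_nonneg.2 (h.con_le y hy j x)
  have h3 := hmin.hasFDerivAt_eq_zero (h1.sub h2)
  rwa [sub_eq_zero.1 h3] at h1

/-- Points no better than `y` form a compact set, by `bounded` and closedness. It contains `y`, so a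
minimizer on it is a minimizer on the whole feasible set. -/
theorem exists_isSolution [ProperSpace E] (h : IsInnerApprox P A) {y : E} (hy : y ∈ P.feasible) :
    ∃ x, (A y).IsSolution x := by
  obtain ⟨D, hD⟩ := h.bounded (P.obj y)
  have hcpt : IsCompact ((A y).feasible ∩ {x | (A y).obj x ≤ (A y).obj y}) := by
    refine Metric.isCompact_of_isClosed_isBounded
      ((h.isClosed_feasible_approx y).inter (isClosed_le (h.continuous_obj y) continuous_const)) ?_
    exact isBounded_iff_forall_norm_le.2 ⟨D, fun x hx => hD y hy le_rfl x hx.1 hx.2⟩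
  obtain ⟨x, hx, hmin⟩ := hcpt.exists_isMinOn ⟨y, h.self_mem_feasible hy, le_refl ((A y).obj y)⟩
    (h.continuous_obj y).continuousOn
  refine ⟨x, hx.1, fun w hw => ?_⟩
  by_cases hwy : (A y).obj w ≤ (A y).obj y
  · exact hmin ⟨hw, hwy⟩
  · exact le_trans hx.2 (not_le.1 hwy).le

/-- The surrogate constraints are nonpositive at both `y` and `x`, hence on the segment by
convexity, and they dominate the original ones. -/
theorem step_mem_feasible (h : IsInnerApprox P A) {y x : E} (hy : y ∈ P.feasible)
    (hx : x ∈ (A y).feasible) {t : ℝ} (ht : 0 ≤ t) (ht1 : t ≤ 1) :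
    y + t • (x - y) ∈ P.feasible := by
  have hxc : x ∈ P.carrier := h.carrier_eq y ▸ hx.1
  have heq : y + t • (x - y) = (1 - t) • y + t • x := by
    rw [smul_sub, sub_smul, one_smul]; abel
  rw [heq]
  refine ⟨h.convex_carrier hy.1 hxc (by linarith) ht (by ring), fun j => ?_⟩
  refine (h.con_le y hy j _).trans (((h.convex_con y hy j).2 hy.1 hxc (by linarith) ht
    (by ring)).trans ?_)
  have h1 := mul_nonpos_of_nonneg_of_nonpos (sub_nonneg.2 ht1) ((h.con_self y j).trans_le (hy.2 j))
  have h2 := mul_nonpos_of_nonneg_of_nonpos ht (hx.2 j)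
  simp only [smul_eq_mul]
  linarith

/-- Around a regular feasible point that is not stationary, the inner approximation has a strictly
feasible point that improves strictly on the point itself. -/
theorem exists_strict_improvement [Fintype J] (h : IsInnerApprox P A) {z : E} (hz : z ∈ P.feasible)
    (hreg : P.IsRegular z) (hns : ¬ P.IsStationary z) :
    ∃ x ∈ P.carrier, (A z).obj x < (A z).obj z ∧ ∀ j, (A z).con j x < 0 := by
  obtain ⟨y, hy, hobj, hcon⟩ := exists_descent_direction h.convex_carrier hz hreg hns
  have h1 := eventually_lt_of_fderiv_neg (h.hasFDerivAt_obj z) hobj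
  have h2 : ∀ᶠ t in 𝓝[>] (0 : ℝ), ∀ j, (A z).con j (z + t • (y - z)) < 0 := by
    refine eventually_all.2 fun j => ?_
    rcases (hz.2 j).lt_or_eq with hj | hj
    · have hc : Continuous fun t : ℝ => (A z).con j (z + t • (y - z)) :=
        (h.continuous_con z j).comp (by fun_prop)
      have := hc.tendsto 0
      simp only [zero_smul, add_zero, h.con_self] at this
      exact (this.mono_left nhdsWithin_le_nhds).eventually_lt_const hj
    · filter_upwards [eventually_lt_of_fderiv_neg (h.hasFDerivAt_con hz j) (hcon j hj)] with t ht
      rwa [h.con_self, hj] at ht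
  have h3 : ∀ᶠ t in 𝓝[>] (0 : ℝ), t < 1 :=
    nhdsWithin_le_nhds (eventually_lt_nhds one_pos)
  obtain ⟨t, ⟨⟨ht1, ht2⟩, ht3⟩, ht0⟩ := (((h1.and h2).and h3).and self_mem_nhdsWithin).exists
  refine ⟨z + t • (y - z), ?_, ht1, ht2⟩
  exact h.convex_carrier.add_smul_sub_mem hz.1 hy ⟨le_of_lt ht0, ht3.le⟩

/-- A zero surrogate decrease contradicts the strict improvement available at a nonstationary
regular point. -/
theorem isStationary_of_isSolution [Fintype J] (h : IsInnerApprox P A) {z x : E}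
    (hz : z ∈ P.feasible) (hreg : P.IsRegular z) (hx : (A z).IsSolution x)
    (hxz : (A z).obj z ≤ (A z).obj x) : P.IsStationary z := by
  by_contra hns
  obtain ⟨w, hw, hlt, hcon⟩ := h.exists_strict_improvement hz hreg hns
  have := hx.2 ⟨(h.carrier_eq z).symm ▸ hw, fun j => (hcon j).le⟩
  exact absurd (hxz.trans this) (not_le.2 hlt)

/-- Regularity is an open condition. -/
theorem eventually_isRegular [Finite J] (h : IsInnerApprox P A) {z : E} (hz : z ∈ P.feasible)
    (hreg : P.IsRegular z) : ∀ᶠ w in 𝓝 z, P.IsRegular w := by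
  obtain ⟨y, hy, hcon⟩ := hreg
  suffices ∀ᶠ w in 𝓝 z, ∀ j, P.con j w = 0 → fderiv ℝ (P.con j) w (y - w) < 0 from
    this.mono fun w hw => ⟨y, hy, hw⟩
  refine eventually_all.2 fun j => ?_
  rcases (hz.2 j).lt_or_eq with hj | hj
  · filter_upwards [((h.contDiff_con j).continuous.tendsto z).eventually_lt_const hj] with w hw hw0
    exact absurd hw0 hw.ne
  · have hc : Continuous fun w => fderiv ℝ (P.con j) w (y - w) :=
      ((h.contDiff_con j).continuous_fderiv one_ne_zero).clm_apply (by fun_prop)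
    filter_upwards [(hc.tendsto z).eventually_lt_const (hcon j hj)] with w hw _
    exact hw

/-- Near a regular feasible point that is not stationary, the surrogate objective can be decreased
by a fixed amount. -/
theorem exists_gap [Fintype J] (h : IsInnerApprox P A) {z : E} (hz : z ∈ P.feasible)
    (hreg : P.IsRegular z) (hns : ¬ P.IsStationary z) :
    ∃ δ > 0, ∀ᶠ w in 𝓝 z, ∀ x, (A w).IsSolution x → (A w).obj x + δ ≤ (A w).obj w := by
  obtain ⟨y, hy, hlt, hcon⟩ := h.exists_strict_improvement hz hreg hns
  -- Half of the improvement at `z` survives small perturbations of the base point. The single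
  -- competitor `y` stays feasible for all nearby approximations and bounds their optimal values.
  refine ⟨((A z).obj z - (A z).obj y) / 2, by linarith, ?_⟩
  have h1 : ∀ᶠ w in 𝓝 z, ∀ j, (A w).con j y < 0 := eventually_all.2 fun j =>
    ((h.continuous_con_left j y).tendsto z).eventually_lt_const (hcon j)
  have hc : Continuous fun w => (A w).obj w - (A w).obj y :=
    h.continuous_obj_diag.sub (h.continuous_obj_left y)
  have h2 := (hc.tendsto z).eventually_const_lt
    (show ((A z).obj z - (A z).obj y) / 2 < (A z).obj z - (A z).obj y by linarith)
  filter_upwards [h1, h2] with w hw1 hw2 x hx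
  have : (A w).obj x ≤ (A w).obj y := hx.2 ⟨(h.carrier_eq w).symm ▸ hy, fun j => (hw1 j).le⟩
  linarith

/-! ### Runs of the algorithm -/

variable {γ : ℕ → ℝ} {z : ℕ → E}

theorem run_mem_feasible [Fintype J] (h : IsInnerApprox P A) (hγ : ∀ v, 0 < γ v ∧ γ v ≤ 1)
    (hz : P.IsSCARun A γ z) (v : ℕ) : z v ∈ P.feasible := by
  induction v with
  | zero => exact hz.1
  | succ v ih =>
    rcases hz.2 v with ⟨x, hx, hstep⟩ | ⟨-, hconst⟩
    · rw [hstep]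
      exact h.step_mem_feasible ih hx.1 (hγ v).1.le (hγ v).2
    · rw [hconst _ v.le_succ]
      exact ih

/-- A run that never stops: bounds on iterates and surrogate solutions, and decrease of the
objective from some iteration on. -/
theorem run_bounds [Fintype J] (h : IsInnerApprox P A) (hγ : ∀ v, 0 < γ v ∧ γ v ≤ 1)
    (hγ0 : Tendsto γ atTop (𝓝 0)) (hz : P.IsSCARun A γ z) {x : ℕ → E}
    (hx : ∀ v, (A (z v)).IsSolution (x v)) (hstep : ∀ v, z (v + 1) = z v + γ v • (x v - z v)) :
    ∃ D V : ℕ, (∀ v, ‖z v‖ ≤ D ∧ ‖x v‖ ≤ D) ∧ ∀ v ≥ V,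
      P.obj (z (v + 1)) ≤ P.obj (z v) + γ v * ((A (z v)).obj (x v) - (A (z v)).obj (z v)) ∧
      P.obj (z (v + 1)) ≤ P.obj (z v) := by
  have hfeas := h.run_mem_feasible hγ hz
  have hgap : ∀ v, (A (z v)).obj (x v) ≤ (A (z v)).obj (z v) := fun v =>
    (hx v).2 (h.self_mem_feasible (hfeas v))
  obtain ⟨C, hC⟩ := h.descent
  have h0 : Tendsto (fun v => γ v * C) atTop (𝓝 0) := by simpa using hγ0.mul_const C
  obtain ⟨V, hV⟩ := eventually_atTop.1 (h0.eventually_le_const one_pos)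
  have hdec : ∀ v ≥ V,
      P.obj (z (v + 1)) ≤ P.obj (z v) + γ v * ((A (z v)).obj (x v) - (A (z v)).obj (z v)) := by
    intro v hv
    rw [hstep]
    exact hC _ (hfeas v) _ ((h.carrier_eq (z v)) ▸ (hx v).1.1) _ (hγ v).1.le (hγ v).2 (hV v hv)
  have hmono : ∀ v ≥ V, P.obj (z (v + 1)) ≤ P.obj (z v) := fun v hv =>
    (hdec v hv).trans (by
      have := mul_nonpos_of_nonneg_of_nonpos (hγ v).1.le (sub_nonpos.2 (hgap v))
      linarith)
  -- Before iteration `V` the objective may increase, but those are finitely many values; from then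
  -- on it is monotone.
  have hR : ∃ R, ∀ v, P.obj (z v) ≤ R := by
    obtain ⟨R, hR⟩ := ((Set.finite_Iic V).image fun v => P.obj (z v)).bddAbove
    refine ⟨R, fun v => ?_⟩
    induction v with
    | zero => exact hR ⟨0, V.zero_le, rfl⟩
    | succ v ih =>
      rcases le_or_gt V v with hv | hv
      · exact (hmono v hv).trans ih
      · exact hR ⟨v + 1, hv, rfl⟩
  obtain ⟨R, hR⟩ := hR
  obtain ⟨D, hD⟩ := h.bounded R
  -- A natural number as bound is automatically nonnegative.
  obtain ⟨D', hD'⟩ := exists_nat_ge D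
  exact ⟨D', V, fun v => ⟨(hD _ (hfeas v) (hR v) _ (h.self_mem_feasible (hfeas v)) le_rfl).trans hD',
    (hD _ (hfeas v) (hR v) _ (hx v).1 (hgap v)).trans hD'⟩, fun v hv => ⟨hdec v hv, hmono v hv⟩⟩

/-- Either the run stops at a stationary point, or it moves at every iteration. -/
theorem run_cases [Fintype J] (hz : P.IsSCARun A γ z) :
    (∃ V, P.IsStationary (z V) ∧ ∀ w, V ≤ w → z w = z V) ∨
      ∃ x : ℕ → E, (∀ v, (A (z v)).IsSolution (x v)) ∧
        ∀ v, z (v + 1) = z v + γ v • (x v - z v) := by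
  by_cases hs : ∃ V, P.IsStationary (z V) ∧ ∀ w, V ≤ w → z w = z V
  · exact .inl hs
  · have := fun v => (hz.2 v).resolve_right fun hv => hs ⟨v, hv⟩
    choose x hx using this
    exact .inr ⟨x, fun v => (hx v).1, fun v => (hx v).2⟩

theorem run_isBounded [Fintype J] (h : IsInnerApprox P A) (hγ : ∀ v, 0 < γ v ∧ γ v ≤ 1)
    (hγ0 : Tendsto γ atTop (𝓝 0)) (hz : P.IsSCARun A γ z) : Bornology.IsBounded (Set.range z) := by
  rcases run_cases hz with ⟨V, -, hV⟩ | ⟨x, hx, hstep⟩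
  · refine (((Set.finite_Iic V).image z).subset ?_).isBounded
    rintro _ ⟨v, rfl⟩
    rcases le_total v V with hv | hv
    · exact ⟨v, hv, rfl⟩
    · exact ⟨V, le_refl V, (hV v hv).symm⟩
  · obtain ⟨D, V, hD, -⟩ := h.run_bounds hγ hγ0 hz hx hstep
    exact isBounded_iff_forall_norm_le.2 ⟨D, by rintro _ ⟨v, rfl⟩; exact (hD v).1⟩

/-- If the objective eventually decreases along the run, then its value at a cluster point is a
lower bound. -/
theorem run_obj_ge [Fintype J] (h : IsInnerApprox P A) {V : ℕ}
    (hmono : ∀ v ≥ V, P.obj (z (v + 1)) ≤ P.obj (z v)) {zlim : E}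
    (hlim : MapClusterPt zlim atTop z) {v : ℕ} (hv : V ≤ v) : P.obj zlim ≤ P.obj (z v) := by
  by_contra! hlt
  have h1 := (h.contDiff_obj.continuous.tendsto zlim).eventually_const_lt hlt
  obtain ⟨w, hw1, hw2⟩ := ((hlim.frequently h1).and_eventually (eventually_ge_atTop v)).exists
  have : P.obj (z w) ≤ P.obj (z v) := by
    induction w, hw2 using Nat.le_induction with
    | base => exact le_rfl
    | succ w hw ih =>
      exact (le_or_gt (P.obj (z w)) (P.obj (z v))).elim
        (fun h' => (hmono w (hv.trans hw)).trans h')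
        (fun h' => (hmono w (hv.trans hw)).trans (ih h'))
  linarith

/-- Regular cluster points of a run are stationary. -/
theorem isStationary_of_mapClusterPt [Fintype J] (h : IsInnerApprox P A)
    (hγ : ∀ v, 0 < γ v ∧ γ v ≤ 1) (hγ0 : Tendsto γ atTop (𝓝 0))
    (hγsum : Tendsto (fun n => ∑ v ∈ Finset.range n, γ v) atTop atTop)
    (hz : P.IsSCARun A γ z) {zlim : E} (hlim : MapClusterPt zlim atTop z)
    (hreg : P.IsRegular zlim) : P.IsStationary zlim := by
  rcases run_cases hz with ⟨V, hst, hV⟩ | ⟨x, hx, hstep⟩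
  · have : Tendsto z atTop (𝓝 (z V)) :=
      tendsto_const_nhds.congr' ((eventually_ge_atTop V).mono fun w hw => (hV w hw).symm)
    have hEq : zlim = z V := by
      by_contra hne
      have hd := (disjoint_nhds_nhds.2 hne).mono_right this
      exact (hlim.neBot).ne (by simpa [disjoint_iff] using hd)
    rwa [hEq]
  by_contra hns
  have hfeas := h.run_mem_feasible hγ hz
  have hzlim : zlim ∈ P.feasible :=
    h.isClosed_feasible.mem_of_mapClusterPt hlim (Eventually.of_forall hfeas)
  obtain ⟨D, V, hD, hdec⟩ := h.run_bounds hγ hγ0 hz hx hstep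
  obtain ⟨δ, hδ, hgap⟩ := h.exists_gap hzlim hreg hns
  obtain ⟨ε, hε, hball⟩ := Metric.eventually_nhds_iff.1 hgap
  have hdist : ∀ v, dist (z (v + 1)) (z v) ≤ γ v * (2 * D) := by
    intro v
    rw [hstep, dist_eq_norm, add_sub_cancel_left, norm_smul, Real.norm_of_nonneg (hγ v).1.le]
    refine mul_le_mul_of_nonneg_left ?_ (hγ v).1.le
    linarith [norm_sub_le (x v) (z v), (hD v).1, (hD v).2]
  -- To travel `ε / 2` inside the ball, the run must lower the objective by at least this amount.
  -- The factor is `2 * D + 1` rather than `2 * D` so that it is positive even when `D = 0`.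
  have hη : 0 < δ * (ε / 2) / (2 * D + 1) := by positivity
  have h1 : ∀ᶠ w in 𝓝 zlim, P.obj w < P.obj zlim + δ * (ε / 2) / (2 * D + 1) :=
    (h.contDiff_obj.continuous.tendsto zlim).eventually_lt_const (by linarith)
  have h2 : ∀ᶠ w in 𝓝 zlim, dist w zlim < ε / 2 := Metric.ball_mem_nhds _ (half_pos hε)
  obtain ⟨v₁, ⟨hv1, hv2⟩, hv3⟩ :=
    ((hlim.frequently (h1.and h2)).and_eventually (eventually_ge_atTop V)).exists
  have hlow : ∀ v, v₁ ≤ v → P.obj zlim ≤ P.obj (z v) := fun v hv =>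
    h.run_obj_ge (fun v hv => (hdec v hv).2) hlim (hv3.trans hv)
  -- After `v₁` the total possible drop of the objective is below the price of travelling `ε / 2`,
  -- so the iterate is still in the `ε`-ball where the gap `δ` is available.
  have hin : ∀ v, δ * dist (z v) (z v₁) ≤ (2 * D + 1) * (P.obj (z v₁) - P.obj (z v)) →
      v₁ ≤ v → dist (z v) zlim < ε := by
    intro v hv hle
    have h3 : P.obj (z v₁) - P.obj (z v) < δ * (ε / 2) / (2 * D + 1) := by linarith [hlow v hle]
    rw [lt_div_iff₀ (by positivity)] at h3
    have h4 : dist (z v) (z v₁) < ε / 2 := lt_of_mul_lt_mul_left (by linarith) hδ.le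
    linarith [dist_triangle (z v) (z v₁) zlim]
  -- Both estimates need the iterate to be in the ball, and the first keeps it there, which closes
  -- the induction; the second sums the decreases `δ * γ i`.
  have hmain : ∀ v, v₁ ≤ v → δ * dist (z v) (z v₁) ≤ (2 * D + 1) * (P.obj (z v₁) - P.obj (z v)) ∧
      P.obj (z v) + δ * ∑ i ∈ Finset.range v, γ i ≤
        P.obj (z v₁) + δ * ∑ i ∈ Finset.range v₁, γ i := by
    intro v hv
    induction v, hv using Nat.le_induction with
    | base => simp
    | succ v hv ih =>
      have hg := hball (hin v ih.1 hv) (x v) (hx v)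
      have h3 : P.obj (z (v + 1)) ≤ P.obj (z v) - γ v * δ := by
        have := mul_le_mul_of_nonneg_left
          (show (A (z v)).obj (x v) - (A (z v)).obj (z v) ≤ -δ by linarith) (hγ v).1.le
        linarith [(hdec v (hv3.trans hv)).1]
      constructor
      · have h4 := dist_triangle (z (v + 1)) (z v) (z v₁)
        have h5 : δ * dist (z (v + 1)) (z v₁) ≤ δ * (γ v * (2 * D) + dist (z v) (z v₁)) :=
          mul_le_mul_of_nonneg_left (by linarith [hdist v]) hδ.le
        have h6 : (2 * D + 1) * (γ v * δ) ≤ (2 * D + 1) * (P.obj (z v) - P.obj (z (v + 1))) :=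
          mul_le_mul_of_nonneg_left (by linarith) (by positivity)
        have h7 := mul_pos (hγ v).1 hδ
        linarith [ih.1]
      · rw [Finset.sum_range_succ]
        linarith [ih.2]
  obtain ⟨v, hv1, hv2⟩ := (((hγsum.const_mul_atTop hδ).eventually_gt_atTop
    (P.obj (z v₁) + δ * ∑ i ∈ Finset.range v₁, γ i)).and (eventually_ge_atTop v₁)).exists
  linarith [(hmain v hv2).2, h.obj_nonneg _ (hfeas v)]

/-- Regular cluster points of a run without stationary iterates are not local maxima. -/
theorem not_isLocalMaxOn_of_mapClusterPt [Fintype J] (h : IsInnerApprox P A)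
    (hγ : ∀ v, 0 < γ v ∧ γ v ≤ 1) (hγ0 : Tendsto γ atTop (𝓝 0))
    (hz : P.IsSCARun A γ z) {zlim : E} (hlim : MapClusterPt zlim atTop z)
    (hreg : P.IsRegular zlim) (hns : ∀ v, ¬ P.IsStationary (z v)) :
    ¬ IsLocalMaxOn P.obj P.feasible zlim := by
  intro hmax
  rcases run_cases hz with ⟨V, hst, -⟩ | ⟨x, hx, hstep⟩
  · exact hns V hst
  have hfeas := h.run_mem_feasible hγ hz
  have hzlim : zlim ∈ P.feasible :=
    h.isClosed_feasible.mem_of_mapClusterPt hlim (Eventually.of_forall hfeas)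
  obtain ⟨D, V, -, hdec⟩ := h.run_bounds hγ hγ0 hz hx hstep
  have hev := (eventually_nhdsWithin_iff.1 hmax).and (h.eventually_isRegular hzlim hreg)
  obtain ⟨v, ⟨hv1, hv2⟩, hv⟩ :=
    ((hlim.frequently hev).and_eventually (eventually_ge_atTop V)).exists
  -- The successor lies above the limiting value and the iterate below it by local maximality, so
  -- the guaranteed decrease at this step must be zero.
  have h1 := h.run_obj_ge (fun v hv => (hdec v hv).2) hlim (hv.trans v.le_succ)
  have h2 := hv1 (hfeas v)
  have h3 : 0 ≤ γ v * ((A (z v)).obj (x v) - (A (z v)).obj (z v)) := by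
    linarith [(hdec v hv).1]
  exact hns v (h.isStationary_of_isSolution (hfeas v) hv2 (hx v)
    (sub_nonneg.1 (nonneg_of_mul_nonneg_right h3 (hγ v).1)))

/-- Convergence of the successive convex approximation scheme. -/
theorem convergence [ProperSpace E] [Fintype J] (h : IsInnerApprox P A)
    (hγ : ∀ v, 0 < γ v ∧ γ v ≤ 1) (hγ0 : Tendsto γ atTop (𝓝 0))
    (hγsum : Tendsto (fun n => ∑ v ∈ Finset.range n, γ v) atTop atTop) :
    (∀ y ∈ P.feasible, ∃ zhat, (A y).IsSolution zhat) ∧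
      ∀ z : ℕ → E, P.IsSCARun A γ z →
        (∀ v, z v ∈ P.feasible) ∧ Bornology.IsBounded (Set.range z) ∧
        ∀ zlim, MapClusterPt zlim atTop z → P.IsRegular zlim →
          P.IsStationary zlim ∧
          ((∀ v, ¬ P.IsStationary (z v)) → ¬ IsLocalMaxOn P.obj P.feasible zlim) :=
  ⟨fun _ hy => h.exists_isSolution hy, fun _ hz => ⟨h.run_mem_feasible hγ hz,
    h.run_isBounded hγ hγ0 hz, fun _ hlim hreg =>
      ⟨h.isStationary_of_mapClusterPt hγ hγ0 hγsum hz hlim hreg,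
        h.not_isLocalMaxOn_of_mapClusterPt hγ hγ0 hz hlim hreg⟩⟩⟩

end IsInnerApprox

end UAV.Program

/-! ## Convexity and differentiation lemmas -/

theorem ConvexOn.finset_sum {E ι : Type*} [AddCommGroup E] [Module ℝ E] {s : Set E}
    (hs : Convex ℝ s) (t : Finset ι) {f : ι → E → ℝ} (hf : ∀ i ∈ t, ConvexOn ℝ s (f i)) :
    ConvexOn ℝ s fun x => ∑ i ∈ t, f i x := by
  refine ⟨hs, fun x hx y hy a b ha hb hab => ?_⟩
  simp only [smul_eq_mul, Finset.mul_sum, ← Finset.sum_add_distrib]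
  exact Finset.sum_le_sum fun i hi => (hf i hi).2 hx hy ha hb hab

/-- A function that differs from a convex one by an affine one is convex. -/
theorem ConvexOn.of_sub_affine {E : Type*} [AddCommGroup E] [Module ℝ E] {s : Set E} {f g : E → ℝ}
    (hg : ConvexOn ℝ s g)
    (haff : ∀ x y : E, ∀ a b : ℝ, a + b = 1 → f (a • x + b • y) - g (a • x + b • y) =
      a * (f x - g x) + b * (f y - g y)) : ConvexOn ℝ s f := by
  refine ⟨hg.1, fun x hx y hy a b ha hb hab => ?_⟩
  have h1 := hg.2 hx hy ha hb hab
  have h2 := haff x y a b hab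
  simp only [smul_eq_mul] at h1 ⊢
  linarith

theorem ConvexOn.const_mul_sq {E : Type*} [AddCommGroup E] [Module ℝ E] {s : Set E} {f : E → ℝ}
    {c : ℝ} (hc : 0 ≤ c) (hf : ConvexOn ℝ s f) (hf0 : ∀ x ∈ s, 0 ≤ f x) :
    ConvexOn ℝ s fun x => c * f x ^ 2 :=
  (hf.pow hf0 2).smul hc

/-- Convexity is preserved by a map that respects convex combinations. -/
theorem ConvexOn.comp_of_map_combination {E F : Type*} [AddCommGroup E] [Module ℝ E]
    [AddCommGroup F] [Module ℝ F] {s : Set E} {t : Set F} {f : F → ℝ} (hf : ConvexOn ℝ t f)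
    (hs : Convex ℝ s) {g : E → F} (hg : ∀ x y : E, ∀ a b : ℝ, g (a • x + b • y) = a • g x + b • g y)
    (hst : ∀ x ∈ s, g x ∈ t) : ConvexOn ℝ s fun x => f (g x) := by
  refine ⟨hs, fun x hx y hy a b ha hb hab => ?_⟩
  simp only [hg]
  exact hf.2 (hst x hx) (hst y hy) ha hb hab

/-- A product of two factors that vanish at a point has derivative zero there. -/
theorem hasFDerivAt_mul_of_eq_zero {E : Type*} [NormedAddCommGroup E] [NormedSpace ℝ E]
    {f g : E → ℝ} {x : E} (hf : DifferentiableAt ℝ f x) (hg : DifferentiableAt ℝ g x)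
    (hf0 : f x = 0) (hg0 : g x = 0) : HasFDerivAt (fun y => f y * g y) (0 : E →L[ℝ] ℝ) x := by
  have h := hf.hasFDerivAt.mul hg.hasFDerivAt
  rw [hf0, hg0, zero_smul, zero_smul, add_zero] at h
  exact h

theorem exists_pos_forall_le {ι : Type*} [Finite ι] {f : ι → ℝ} (hf : ∀ i, 0 < f i) :
    ∃ c > 0, ∀ i, c ≤ f i := by
  rcases isEmpty_or_nonempty ι with _ | _
  · exact ⟨1, one_pos, fun i => isEmptyElim i⟩
  · obtain ⟨i, hi⟩ := Finite.exists_min f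
    exact ⟨f i, hf i, hi⟩

namespace UAV

/-! ## The rate function -/

/-- The function `L ↦ 2 ^ (L / c) - 1`. -/
noncomputable def rate (c L : ℝ) : ℝ := (2 : ℝ) ^ (L / c) - 1

/-- The tangent-line inequality for the exponential, from `x + 1 ≤ exp x`. It yields both convexity
and the Lipschitz bound, and supplies the linearization in the surrogates. -/
theorem rate_sub_ge (c L Lv : ℝ) :
    Real.log 2 / c * (2 : ℝ) ^ (Lv / c) * (L - Lv) ≤ rate c L - rate c Lv := by
  simp only [rate, Real.rpow_def_of_pos two_pos]
  have h := mul_le_mul_of_nonneg_left (Real.add_one_le_exp (Real.log 2 * (L / c) -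
    Real.log 2 * (Lv / c))) (Real.exp_pos (Real.log 2 * (Lv / c))).le
  rw [← Real.exp_add, add_sub_cancel] at h
  have h2 : Real.log 2 / c * Real.exp (Real.log 2 * (Lv / c)) * (L - Lv) =
    Real.exp (Real.log 2 * (Lv / c)) * (Real.log 2 * (L / c) - Real.log 2 * (Lv / c)) := by ring
  linarith

theorem rate_nonneg {c L : ℝ} (hc : 0 ≤ c) (hL : 0 ≤ L) : 0 ≤ rate c L :=
  sub_nonneg.2 (Real.one_le_rpow one_le_two (div_nonneg hL hc))

theorem convexOn_rate (c : ℝ) : ConvexOn ℝ Set.univ (rate c) := by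
  refine ⟨convex_univ, fun x _ y _ a b ha hb hab => ?_⟩
  have h1 := mul_le_mul_of_nonneg_left (rate_sub_ge c x (a • x + b • y)) ha
  have h2 := mul_le_mul_of_nonneg_left (rate_sub_ge c y (a • x + b • y)) hb
  simp only [smul_eq_mul] at h1 h2 ⊢
  generalize Real.log 2 / c * (2 : ℝ) ^ ((a * x + b * y) / c) = s at h1 h2
  obtain rfl : b = 1 - a := by linarith
  linarith

theorem contDiff_rate (c : ℝ) : ContDiff ℝ 1 (rate c) := by
  have : rate c = fun L => Real.exp (Real.log 2 * (L / c)) - 1 := by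
    funext L; simp only [rate, Real.rpow_def_of_pos two_pos]
  rw [this]
  fun_prop

/-- The slope increases, so its value at the right end `D` serves as Lipschitz constant; no lower
bound on the arguments is needed. -/
theorem abs_rate_sub_le {c D L Lv : ℝ} (hc : 0 ≤ c) (hL : L ≤ D) (hLv : Lv ≤ D) :
    |rate c L - rate c Lv| ≤ Real.log 2 / c * (2 : ℝ) ^ (D / c) * |L - Lv| := by
  have key : ∀ x y : ℝ, x ≤ D → rate c x - rate c y ≤
      Real.log 2 / c * (2 : ℝ) ^ (D / c) * |x - y| := by
    intro x y hx
    have h1 := rate_sub_ge c y x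
    have hlog : 0 ≤ Real.log 2 / c := div_nonneg (Real.log_nonneg one_le_two) hc
    have h2 : (2 : ℝ) ^ (x / c) ≤ (2 : ℝ) ^ (D / c) :=
      Real.rpow_le_rpow_of_exponent_le one_le_two (by gcongr)
    calc rate c x - rate c y ≤ Real.log 2 / c * (2 : ℝ) ^ (x / c) * (x - y) := by linarith
      _ ≤ Real.log 2 / c * (2 : ℝ) ^ (x / c) * |x - y| := by
        gcongr
        exact le_abs_self _
      _ ≤ _ := by gcongr
  refine abs_sub_le_iff.2 ⟨key _ _ hL, ?_⟩
  rw [abs_sub_comm]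
  exact key _ _ hLv

/-- The convex upper bound of a product of nonnegative functions, given lower bounds `t₁`, `t₂` of
their increments. -/
theorem mul_le_half_sq {h₁ h₂ v₁ v₂ t₁ t₂ : ℝ} (hv₁ : 0 ≤ v₁) (hv₂ : 0 ≤ v₂) (ht₁ : t₁ ≤ h₁ - v₁)
    (ht₂ : t₂ ≤ h₂ - v₂) :
    h₁ * h₂ ≤ 1 / 2 * ((h₁ + h₂) ^ 2 - v₁ ^ 2 - v₂ ^ 2) - v₁ * t₁ - v₂ * t₂ := by
  -- Nonnegativity of `v₁` and `v₂` is what allows the true increments to be replaced by their lower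
  -- bounds `t₁` and `t₂`.
  have h1 := mul_le_mul_of_nonneg_left ht₁ hv₁
  have h2 := mul_le_mul_of_nonneg_left ht₂ hv₂
  linarith [sq_nonneg (h₁ - v₁), sq_nonneg (h₂ - v₂)]

namespace Params

variable {K : ℕ} (S : Params K)

/-! ### Convex majorants of the energies -/

theorem oRate_eq (L : ℝ) : S.oRate L = rate (S.B * S.Δ / K) L := rfl

theorem distSq_ge (k : Fin K) (p : Plane) : S.H ^ 2 ≤ S.distSq k p := by
  unfold distSq
  linarith [sq_nonneg (p 0 - S.pos k 0), sq_nonneg (p 1 - S.pos k 1)]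

theorem distSq_pos (k : Fin K) (p : Plane) : 0 < S.distSq k p :=
  (pow_pos S.H_pos 2).trans_le (S.distSq_ge k p)

theorem distSq_sub_ge (k : Fin K) (p pv : Plane) :
    2 * ((pv 0 - S.pos k 0) * (p 0 - pv 0) + (pv 1 - S.pos k 1) * (p 1 - pv 1)) ≤
      S.distSq k p - S.distSq k pv := by
  unfold distSq
  linarith [sq_nonneg (p 0 - pv 0), sq_nonneg (p 1 - pv 1)]

theorem convexOn_distSq (k : Fin K) : ConvexOn ℝ Set.univ (S.distSq k) := by
  refine ⟨convex_univ, fun x _ y _ a b ha hb hab => ?_⟩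
  have h1 := mul_le_mul_of_nonneg_left (S.distSq_sub_ge k x (a • x + b • y)) ha
  have h2 := mul_le_mul_of_nonneg_left (S.distSq_sub_ge k y (a • x + b • y)) hb
  have e : ∀ c, (a • x + b • y) c = a * x c + b * y c := fun c => rfl
  simp only [smul_eq_mul, e] at h1 h2 ⊢
  generalize S.distSq k (a • x + b • y) = s at h1 h2 ⊢
  obtain rfl : b = 1 - a := by linarith
  linarith

theorem abs_distSq_sub_le (k : Fin K) {D : ℝ} {p pv : Plane} (hp : ‖p‖ ≤ D) (hpv : ‖pv‖ ≤ D) :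
    |S.distSq k p - S.distSq k pv| ≤
      (2 * D + 2 * ‖S.pos k‖) * (|p 0 - pv 0| + |p 1 - pv 1|) := by
  have hc : ∀ c, |(p c - S.pos k c) ^ 2 - (pv c - S.pos k c) ^ 2| ≤
      (2 * D + 2 * ‖S.pos k‖) * |p c - pv c| := by
    intro c
    have h1 := (PiLp.norm_apply_le p c).trans hp
    have h2 := (PiLp.norm_apply_le pv c).trans hpv
    have h3 := PiLp.norm_apply_le (S.pos k) c
    rw [Real.norm_eq_abs, abs_le] at h1 h2 h3
    rw [show (p c - S.pos k c) ^ 2 - (pv c - S.pos k c) ^ 2 =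
      (p c + pv c - 2 * S.pos k c) * (p c - pv c) by ring, abs_mul]
    refine mul_le_mul_of_nonneg_right (abs_le.2 ⟨?_, ?_⟩) (abs_nonneg _) <;> linarith
  have : S.distSq k p - S.distSq k pv = ((p 0 - S.pos k 0) ^ 2 - (pv 0 - S.pos k 0) ^ 2) +
      ((p 1 - S.pos k 1) ^ 2 - (pv 1 - S.pos k 1) ^ 2) := by
    unfold distSq; ring
  rw [this, mul_add]
  exact (abs_add_le _ _).trans (add_le_add (hc 0) (hc 1))

/-- CPU load. -/
def load (l : Fin K → ℝ) : ℝ := ∑ k, S.C k * l k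

theorem load_combination (x y : Fin K → ℝ) (a b : ℝ) :
    S.load (a • x + b • y) = a * S.load x + b * S.load y := by
  simp only [load, Finset.mul_sum, ← Finset.sum_add_distrib]
  exact Finset.sum_congr rfl fun k _ => by simp; ring

theorem compEnergy_eq (k : Fin K) (l : Fin K → ℝ) :
    S.compEnergy k l = S.γc * S.C k / S.Δ ^ 2 * (l k * S.load l ^ 2) := by
  unfold compEnergy load; ring

/-- Exposes the pattern of `mul_le_half_sq` with factors `l k` and `load ^ 2`, the form used for
majorization, agreement and convexity. -/
theorem compSurr_eq (k : Fin K) (l lv : Fin K → ℝ) :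
    S.compSurr k l lv = S.γc * S.C k / S.Δ ^ 2 *
      (1 / 2 * ((l k + S.load l ^ 2) ^ 2 - lv k ^ 2 - (S.load lv ^ 2) ^ 2) - lv k * (l k - lv k)
        - S.load lv ^ 2 * (2 * S.load lv * (S.load l - S.load lv))) := by
  have : ∑ k', S.C k' * (l k' - lv k') = S.load l - S.load lv := by
    simp [load, mul_sub, Finset.sum_sub_distrib]
  unfold compSurr
  rw [this]
  unfold load
  ring

theorem compCoeff_nonneg (k : Fin K) : 0 ≤ S.γc * S.C k / S.Δ ^ 2 := by
  have := S.γc_pos; have := S.C_pos k; positivity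

theorem compEnergy_le_compSurr (k : Fin K) (l : Fin K → ℝ) {lv : Fin K → ℝ} (hlv : 0 ≤ lv k) :
    S.compEnergy k l ≤ S.compSurr k l lv := by
  rw [compEnergy_eq, compSurr_eq]
  refine mul_le_mul_of_nonneg_left ?_ (S.compCoeff_nonneg k)
  exact mul_le_half_sq hlv (sq_nonneg _) le_rfl (by linarith [sq_nonneg (S.load l - S.load lv)])

theorem compSurr_self (k : Fin K) (l : Fin K → ℝ) : S.compSurr k l l = S.compEnergy k l := by
  rw [compEnergy_eq, compSurr_eq]; ring

theorem compEnergy_nonneg (k : Fin K) {l : Fin K → ℝ} (hl : 0 ≤ l k) : 0 ≤ S.compEnergy k l := by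
  rw [compEnergy_eq]
  exact mul_nonneg (S.compCoeff_nonneg k) (mul_nonneg hl (sq_nonneg _))

/-- Up to an affine function only the square of `l k + load ^ 2` remains. Squaring preserves
convexity because this sum is nonnegative, hence the restriction to `0 ≤ l k`. -/
theorem convexOn_compSurr (k : Fin K) (lv : Fin K → ℝ) :
    ConvexOn ℝ {l : Fin K → ℝ | 0 ≤ l k} fun l => S.compSurr k l lv := by
  have hs : Convex ℝ {l : Fin K → ℝ | 0 ≤ l k} := fun x hx y hy a b ha hb _ =>
    add_nonneg (mul_nonneg ha hx) (mul_nonneg hb hy)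
  have hload : ConvexOn ℝ {l : Fin K → ℝ | 0 ≤ l k} fun l => S.load l ^ 2 :=
    (even_two.convexOn_pow (𝕜 := ℝ)).comp_of_map_combination hs S.load_combination
      fun _ _ => trivial
  have hlin : ConvexOn ℝ {l : Fin K → ℝ | 0 ≤ l k} fun l => l k :=
    (convexOn_id convex_univ).comp_of_map_combination hs (fun _ _ _ _ => rfl) fun _ _ => trivial
  refine ((hlin.add hload).const_mul_sq (div_nonneg (S.compCoeff_nonneg k) two_pos.le)
    fun l hl => add_nonneg hl (sq_nonneg _)).of_sub_affine fun x y a b hab => ?_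
  simp only [compSurr_eq, Pi.add_apply, load_combination, Pi.smul_apply, smul_eq_mul]
  obtain rfl : b = 1 - a := by linarith
  ring

/-- Noise energy in one frame. -/
def noise : ℝ := S.N₀ * S.B * S.Δ

theorem noise_pos : 0 < S.noise := mul_pos (mul_pos S.N₀_pos S.B_pos) S.Δ_pos

/-- Dividing by the gain is multiplying by the squared distance, so the energy is a product of two
convex functions. -/
theorem oEnergy_eq (k : Fin K) (L : ℝ) (p : Plane) :
    S.oEnergy k L p = S.noise / K / S.g₀ * (S.oRate L * S.distSq k p) := by
  have := (S.distSq_pos k p).ne'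
  have := S.g₀_pos.ne'
  unfold oEnergy gain noise
  field_simp

theorem oDownSurr_eq (k : Fin K) (L : ℝ) (p : Plane) (Lv : ℝ) (pv : Plane) :
    S.oDownSurr k L p Lv pv = S.noise / K / S.g₀ *
      (1 / 2 * ((S.oRate L + S.distSq k p) ^ 2 - S.oRate Lv ^ 2 - S.distSq k pv ^ 2)
        - S.oRate Lv * (Real.log 2 / (S.B * S.Δ / K) * (2 : ℝ) ^ (Lv / (S.B * S.Δ / K)) * (L - Lv))
        - S.distSq k pv * (2 * ((pv 0 - S.pos k 0) * (p 0 - pv 0) +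
          (pv 1 - S.pos k 1) * (p 1 - pv 1)))) := by
  -- The factor `1 / K` of the energy cancels against the bandwidth share in the rate derivative; a
  -- user `k : Fin K` exists, so `K` is nonzero.
  have hK : (K : ℝ) ≠ 0 := by exact_mod_cast (Fin.pos k).ne'
  have := S.B_pos.ne'
  have := S.Δ_pos.ne'
  have := S.g₀_pos.ne'
  unfold oDownSurr noise
  generalize (2 : ℝ) ^ (Lv / (S.B * S.Δ / K)) = e
  field_simp

theorem oCoeff_nonneg : 0 ≤ S.noise / K / S.g₀ := by
  have := S.noise_pos; have := S.g₀_pos; positivity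

theorem oWidth_nonneg : 0 ≤ S.B * S.Δ / K := by
  have := S.B_pos; have := S.Δ_pos; positivity

theorem nWidth_nonneg : 0 ≤ S.B * S.Δ := (mul_pos S.B_pos S.Δ_pos).le

theorem oRate_nonneg {L : ℝ} (hL : 0 ≤ L) : 0 ≤ S.oRate L := rate_nonneg S.oWidth_nonneg hL

theorem nRate_nonneg {L : ℝ} (hL : 0 ≤ L) : 0 ≤ S.nRate L := rate_nonneg S.nWidth_nonneg hL

theorem oEnergy_le_oDownSurr (k : Fin K) (L : ℝ) (p : Plane) {Lv : ℝ} (pv : Plane) (hLv : 0 ≤ Lv) :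
    S.oEnergy k L p ≤ S.oDownSurr k L p Lv pv := by
  rw [oEnergy_eq, oDownSurr_eq]
  exact mul_le_mul_of_nonneg_left (mul_le_half_sq (S.oRate_nonneg hLv) (S.distSq_pos k pv).le
    (rate_sub_ge _ _ _) (S.distSq_sub_ge k p pv)) S.oCoeff_nonneg

theorem oDownSurr_self (k : Fin K) (L : ℝ) (p : Plane) :
    S.oDownSurr k L p L p = S.oEnergy k L p := by
  rw [oEnergy_eq, oDownSurr_eq]; ring

theorem convexOn_oDownSurr (k : Fin K) (Lv : ℝ) (pv : Plane) :
    ConvexOn ℝ (Set.Ici 0 ×ˢ Set.univ) fun q : ℝ × Plane => S.oDownSurr k q.1 q.2 Lv pv := by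
  have hs : Convex ℝ (Set.Ici (0 : ℝ) ×ˢ (Set.univ : Set Plane)) :=
    (convex_Ici 0).prod convex_univ
  have h1 : ConvexOn ℝ (Set.Ici (0 : ℝ) ×ˢ (Set.univ : Set Plane)) fun q => S.oRate q.1 :=
    (convexOn_rate _).comp_of_map_combination hs (fun _ _ _ _ => rfl) fun _ _ => trivial
  have h2 : ConvexOn ℝ (Set.Ici (0 : ℝ) ×ˢ (Set.univ : Set Plane)) fun q => S.distSq k q.2 :=
    (S.convexOn_distSq k).comp_of_map_combination hs (fun _ _ _ _ => rfl) fun _ _ => trivial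
  refine ((h1.add h2).const_mul_sq (div_nonneg S.oCoeff_nonneg two_pos.le)
    fun q hq => add_nonneg (S.oRate_nonneg hq.1) (S.distSq_pos k _).le).of_sub_affine
    fun x y a b hab => ?_
  have e1 : (a • x + b • y).1 = a * x.1 + b * y.1 := rfl
  have e2 : ∀ c, (a • x + b • y).2 c = a * x.2 c + b * y.2 c := fun _ => rfl
  simp only [oDownSurr_eq, Pi.add_apply, e2]
  generalize S.oRate (a • x + b • y).1 = r
  generalize S.distSq k (a • x + b • y).2 = d
  rw [e1]
  obtain rfl : b = 1 - a := by linarith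
  ring

/-- Total energy of the other users. -/
def others (k : Fin K) (α : Fin K → ℝ) : ℝ := ∑ k' ∈ Finset.univ.erase k, α k'

theorem others_combination (k : Fin K) (x y : Fin K → ℝ) (a b : ℝ) :
    others k (a • x + b • y) = a * others k x + b * others k y := by
  simp only [others, Finset.mul_sum, ← Finset.sum_add_distrib]
  rfl

theorem others_sub (k : Fin K) (x y : Fin K → ℝ) :
    ∑ k' ∈ Finset.univ.erase k, (x k' - y k') = others k x - others k y :=
  Finset.sum_sub_distrib _ _

theorem others_nonneg (k : Fin K) {α : Fin K → ℝ} (hα : ∀ k, 0 ≤ α k) : 0 ≤ others k α :=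
  Finset.sum_nonneg fun k' _ => hα k'

/-- The gain cancels, so the uplink slack constraint does not depend on the position. -/
theorem gain_mul_nUpEnergy (k : Fin K) (L : ℝ) (p : Plane) (α : Fin K → ℝ) :
    S.gain k p * S.nUpEnergy k L p α = S.noise * S.nRate L + S.nRate L * others k α := by
  have : S.gain k p ≠ 0 := (div_pos S.g₀_pos (S.distSq_pos k p)).ne'
  unfold nUpEnergy noise others
  field_simp

theorem nUpSurr_eq (k : Fin K) (L : ℝ) (α : Fin K → ℝ) (Lv : ℝ) (αv : Fin K → ℝ) :
    S.nUpSurr k L α Lv αv = S.noise * S.nRate L +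
      (1 / 2 * ((S.nRate L + others k α) ^ 2 - S.nRate Lv ^ 2 - others k αv ^ 2)
        - S.nRate Lv * (Real.log 2 / (S.B * S.Δ) * (2 : ℝ) ^ (Lv / (S.B * S.Δ)) * (L - Lv))
        - others k αv * (others k α - others k αv)) := by
  unfold nUpSurr
  rw [others_sub]
  unfold noise others
  ring

theorem nDownEnergy_eq (k : Fin K) (L : ℝ) (p : Plane) (β : Fin K → ℝ) :
    S.nDownEnergy k L p β =
      S.noise / S.g₀ * (S.nRate L * S.distSq k p) + S.nRate L * others k β := by
  have := (S.distSq_pos k p).ne'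
  have := S.g₀_pos.ne'
  unfold nDownEnergy gain noise others
  field_simp

theorem nDownSurr_eq (k : Fin K) (L : ℝ) (p : Plane) (β : Fin K → ℝ) (Lv : ℝ) (pv : Plane)
    (βv : Fin K → ℝ) : S.nDownSurr k L p β Lv pv βv = S.noise / S.g₀ *
      (1 / 2 * ((S.nRate L + S.distSq k p) ^ 2 - S.nRate Lv ^ 2 - S.distSq k pv ^ 2)
        - S.nRate Lv * (Real.log 2 / (S.B * S.Δ) * (2 : ℝ) ^ (Lv / (S.B * S.Δ)) * (L - Lv))
        - S.distSq k pv * (2 * ((pv 0 - S.pos k 0) * (p 0 - pv 0) +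
          (pv 1 - S.pos k 1) * (p 1 - pv 1)))) +
      (1 / 2 * ((S.nRate L + others k β) ^ 2 - S.nRate Lv ^ 2 - others k βv ^ 2)
        - S.nRate Lv * (Real.log 2 / (S.B * S.Δ) * (2 : ℝ) ^ (Lv / (S.B * S.Δ)) * (L - Lv))
        - others k βv * (others k β - others k βv)) := by
  have := S.B_pos.ne'
  have := S.Δ_pos.ne'
  have := S.g₀_pos.ne'
  unfold nDownSurr
  rw [others_sub]
  unfold noise others
  generalize (2 : ℝ) ^ (Lv / (S.B * S.Δ)) = e
  field_simp
  ring

theorem nUpEnergy_le_nUpSurr (k : Fin K) (L : ℝ) (p : Plane) (α : Fin K → ℝ) {Lv : ℝ}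
    {αv : Fin K → ℝ} (hLv : 0 ≤ Lv) (hαv : ∀ k, 0 ≤ αv k) :
    S.gain k p * S.nUpEnergy k L p α ≤ S.nUpSurr k L α Lv αv := by
  rw [gain_mul_nUpEnergy, nUpSurr_eq]
  exact add_le_add_right (mul_le_half_sq (S.nRate_nonneg hLv) (others_nonneg k hαv)
    (rate_sub_ge _ _ _) le_rfl) _

theorem nUpSurr_self (k : Fin K) (L : ℝ) (p : Plane) (α : Fin K → ℝ) :
    S.nUpSurr k L α L α = S.gain k p * S.nUpEnergy k L p α := by
  rw [gain_mul_nUpEnergy, nUpSurr_eq]; ring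

theorem nDownCoeff_nonneg : 0 ≤ S.noise / S.g₀ := (div_pos S.noise_pos S.g₀_pos).le

theorem nDownEnergy_le_nDownSurr (k : Fin K) (L : ℝ) (p : Plane) (β : Fin K → ℝ) {Lv : ℝ}
    (pv : Plane) {βv : Fin K → ℝ} (hLv : 0 ≤ Lv) (hβv : ∀ k, 0 ≤ βv k) :
    S.nDownEnergy k L p β ≤ S.nDownSurr k L p β Lv pv βv := by
  rw [nDownEnergy_eq, nDownSurr_eq]
  exact add_le_add
    (mul_le_mul_of_nonneg_left (mul_le_half_sq (S.nRate_nonneg hLv) (S.distSq_pos k pv).le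
      (rate_sub_ge _ _ _) (S.distSq_sub_ge k p pv)) S.nDownCoeff_nonneg)
    (mul_le_half_sq (S.nRate_nonneg hLv) (others_nonneg k hβv) (rate_sub_ge _ _ _) le_rfl)

theorem nDownSurr_self (k : Fin K) (L : ℝ) (p : Plane) (β : Fin K → ℝ) :
    S.nDownSurr k L p β L p β = S.nDownEnergy k L p β := by
  rw [nDownEnergy_eq, nDownSurr_eq]; ring

theorem convexOn_nUpSurr (k : Fin K) (Lv : ℝ) (αv : Fin K → ℝ) :
    ConvexOn ℝ (Set.Ici 0 ×ˢ {α : Fin K → ℝ | ∀ k, 0 ≤ α k}) fun q : ℝ × (Fin K → ℝ) =>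
      S.nUpSurr k q.1 q.2 Lv αv := by
  have hs : Convex ℝ (Set.Ici (0 : ℝ) ×ˢ {α : Fin K → ℝ | ∀ k, 0 ≤ α k}) :=
    (convex_Ici 0).prod fun x hx y hy a b ha hb _ k =>
      add_nonneg (mul_nonneg ha (hx k)) (mul_nonneg hb (hy k))
  have h1 : ConvexOn ℝ (Set.Ici (0 : ℝ) ×ˢ {α : Fin K → ℝ | ∀ k, 0 ≤ α k})
      fun q => S.nRate q.1 :=
    (convexOn_rate _).comp_of_map_combination hs (fun _ _ _ _ => rfl) fun _ _ => trivial
  have h2 : ConvexOn ℝ (Set.Ici (0 : ℝ) ×ˢ {α : Fin K → ℝ | ∀ k, 0 ≤ α k})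
      fun q => others k q.2 :=
    (convexOn_id convex_univ).comp_of_map_combination hs
      (fun x y a b => others_combination k x.2 y.2 a b) fun _ _ => trivial
  refine ((h1.smul S.noise_pos.le).add ((h1.add h2).const_mul_sq one_half_pos.le
    fun q hq => add_nonneg (S.nRate_nonneg hq.1) (others_nonneg k hq.2))).of_sub_affine
    fun x y a b hab => ?_
  have e1 : (a • x + b • y).1 = a * x.1 + b * y.1 := rfl
  have e2 : others k (a • x + b • y).2 = a * others k x.2 + b * others k y.2 :=
    others_combination k x.2 y.2 a b
  simp only [nUpSurr_eq, Pi.add_apply, e2, smul_eq_mul]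
  generalize S.nRate (a • x + b • y).1 = r
  rw [e1]
  obtain rfl : b = 1 - a := by linarith
  ring

theorem convexOn_nDownSurr (k : Fin K) (Lv : ℝ) (pv : Plane) (βv : Fin K → ℝ) :
    ConvexOn ℝ (Set.Ici 0 ×ˢ Set.univ ×ˢ {β : Fin K → ℝ | ∀ k, 0 ≤ β k})
      fun q : ℝ × Plane × (Fin K → ℝ) => S.nDownSurr k q.1 q.2.1 q.2.2 Lv pv βv := by
  have hs : Convex ℝ
      (Set.Ici (0 : ℝ) ×ˢ (Set.univ : Set Plane) ×ˢ {β : Fin K → ℝ | ∀ k, 0 ≤ β k}) :=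
    (convex_Ici 0).prod (convex_univ.prod fun x hx y hy a b ha hb _ k =>
      add_nonneg (mul_nonneg ha (hx k)) (mul_nonneg hb (hy k)))
  have h1 : ConvexOn ℝ (Set.Ici (0 : ℝ) ×ˢ (Set.univ : Set Plane) ×ˢ
      {β : Fin K → ℝ | ∀ k, 0 ≤ β k}) fun q => S.nRate q.1 :=
    (convexOn_rate _).comp_of_map_combination hs (fun _ _ _ _ => rfl) fun _ _ => trivial
  have h2 : ConvexOn ℝ (Set.Ici (0 : ℝ) ×ˢ (Set.univ : Set Plane) ×ˢ
      {β : Fin K → ℝ | ∀ k, 0 ≤ β k}) fun q => S.distSq k q.2.1 :=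
    (S.convexOn_distSq k).comp_of_map_combination hs (fun _ _ _ _ => rfl) fun _ _ => trivial
  have h3 : ConvexOn ℝ (Set.Ici (0 : ℝ) ×ˢ (Set.univ : Set Plane) ×ˢ
      {β : Fin K → ℝ | ∀ k, 0 ≤ β k}) fun q => others k q.2.2 :=
    (convexOn_id convex_univ).comp_of_map_combination hs
      (fun x y a b => others_combination k x.2.2 y.2.2 a b) fun _ _ => trivial
  refine (((h1.add h2).const_mul_sq (div_nonneg S.nDownCoeff_nonneg two_pos.le)
    fun q hq => add_nonneg (S.nRate_nonneg hq.1) (S.distSq_pos k _).le).add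
    ((h1.add h3).const_mul_sq one_half_pos.le fun q hq =>
      add_nonneg (S.nRate_nonneg hq.1) (others_nonneg k hq.2.2))).of_sub_affine
    fun x y a b hab => ?_
  have e1 : (a • x + b • y).1 = a * x.1 + b * y.1 := rfl
  have e2 : ∀ c, (a • x + b • y).2.1 c = a * x.2.1 c + b * y.2.1 c := fun _ => rfl
  have e3 : others k (a • x + b • y).2.2 = a * others k x.2.2 + b * others k y.2.2 :=
    others_combination k x.2.2 y.2.2 a b
  simp only [nDownSurr_eq, Pi.add_apply, e2, e3]
  generalize S.nRate (a • x + b • y).1 = r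
  generalize S.distSq k (a • x + b • y).2.1 = d
  rw [e1]
  obtain rfl : b = 1 - a := by linarith
  ring

end Params

end UAV

namespace UAV

namespace Params

variable {K : ℕ} (S : Params K)

/-! ### Partial linearization of products -/

/-- Partial linearization of `c₀ * (a L * distSq k p)` with proximal terms. -/
noncomputable def productSurr (k : Fin K) (c₀ : ℝ) (a : ℝ → ℝ) (τ τx τy L : ℝ) (p : Plane) (Lv : ℝ)
    (pv : Plane) : ℝ :=
  c₀ * (a L * S.distSq k pv + a Lv * S.distSq k p) + τ / 2 * (L - Lv) ^ 2 +
    τx / 2 * (p 0 - pv 0) ^ 2 + τy / 2 * (p 1 - pv 1) ^ 2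

/-- Partial linearization counts the product twice. This is harmless because descent compares
differences of surrogate values only. -/
theorem productSurr_self (k : Fin K) (c₀ : ℝ) (a : ℝ → ℝ) (τ τx τy L : ℝ) (p : Plane) :
    S.productSurr k c₀ a τ τx τy L p L p = 2 * (c₀ * (a L * S.distSq k p)) := by
  unfold productSurr; ring

theorem oUpSurr_eq (k : Fin K) (τL τx τy L : ℝ) (p : Plane) (Lv : ℝ) (pv : Plane) :
    S.oUpSurr k τL τx τy L p Lv pv =
      S.productSurr k (S.noise / K / S.g₀) S.oRate τL τx τy L p Lv pv := by
  unfold oUpSurr productSurr noise; ring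

theorem nObjSurr_eq (k : Fin K) (τα τx τy α : ℝ) (p : Plane) (αv : ℝ) (pv : Plane) :
    S.nObjSurr k τα τx τy α p αv pv =
      S.productSurr k (1 / S.g₀) id τα τx τy α p αv pv := by
  simp only [nObjSurr, productSurr, id]; ring

theorem div_gain_eq (k : Fin K) (α : ℝ) (p : Plane) :
    α / S.gain k p = 1 / S.g₀ * (id α * S.distSq k p) := by
  simp only [gain, id, div_div_eq_mul_div]; ring

/-- Up to a constant, the difference is `-c₀` times the product of the increments of the two
factors, plus proximal squares; each is a product of terms vanishing at `y`. -/
theorem hasFDerivAt_productSurr_sub {E : Type*} [NormedAddCommGroup E] [NormedSpace ℝ E]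
    (k : Fin K) (c₀ : ℝ) {a : ℝ → ℝ} (ha : Differentiable ℝ a) (τ τx τy : ℝ) {w : E → ℝ}
    {p : E → Plane} {y : E} (hw : DifferentiableAt ℝ w y) (hp : DifferentiableAt ℝ p y) :
    HasFDerivAt (fun z => S.productSurr k c₀ a τ τx τy (w z) (p z) (w y) (p y) -
      c₀ * (a (w z) * S.distSq k (p z))) (0 : E →L[ℝ] ℝ) y := by
  have hd : DifferentiableAt ℝ (fun z => S.distSq k (p z)) y := by
    unfold distSq; fun_prop
  have h1 : HasFDerivAt (fun z => (a (w z) - a (w y)) * (S.distSq k (p z) - S.distSq k (p y)))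
      (0 : E →L[ℝ] ℝ) y :=
    hasFDerivAt_mul_of_eq_zero (by fun_prop) (by fun_prop) (sub_self _) (sub_self _)
  have h2 : HasFDerivAt (fun z => (w z - w y) * (w z - w y)) (0 : E →L[ℝ] ℝ) y :=
    hasFDerivAt_mul_of_eq_zero (by fun_prop) (by fun_prop) (sub_self _) (sub_self _)
  have h3 : ∀ c, HasFDerivAt (fun z => (p z c - p y c) * (p z c - p y c)) (0 : E →L[ℝ] ℝ) y :=
    fun c => hasFDerivAt_mul_of_eq_zero (by fun_prop) (by fun_prop) (sub_self _) (sub_self _)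
  have h := ((((h1.const_mul (-c₀)).add (h2.const_mul (τ / 2))).add
    ((h3 0).const_mul (τx / 2))).add ((h3 1).const_mul (τy / 2))).add_const
    (c₀ * (a (w y) * S.distSq k (p y)))
  simp only [smul_zero, add_zero] at h
  refine h.congr_of_eventuallyEq (Eventually.of_forall fun z => ?_)
  simp only [productSurr, Pi.add_apply]
  ring

theorem hasFDerivAt_sum_productSurr {E : Type*} [NormedAddCommGroup E] [NormedSpace ℝ E] {n : ℕ}
    (c₀ : ℝ) {a : ℝ → ℝ} (ha : Differentiable ℝ a) (τ : Fin K → Fin n → ℝ) (τx τy : Fin n → ℝ)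
    {w : Fin K → Fin n → E → ℝ} {p : Fin n → E → Plane} {y : E}
    (hw : ∀ k i, DifferentiableAt ℝ (w k i) y) (hp : ∀ i, DifferentiableAt ℝ (p i) y) :
    HasFDerivAt (fun z => ∑ k, ∑ i, S.productSurr k c₀ a (τ k i) (τx i) (τy i) (w k i z) (p i z)
        (w k i y) (p i y))
      (fderiv ℝ (fun z => ∑ k, ∑ i, c₀ * (a (w k i z) * S.distSq k (p i z))) y) y := by
  have h1 : HasFDerivAt (fun z => ∑ k, ∑ i, (S.productSurr k c₀ a (τ k i) (τx i) (τy i)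
      (w k i z) (p i z) (w k i y) (p i y) - c₀ * (a (w k i z) * S.distSq k (p i z))))
      (∑ _k : Fin K, ∑ _i : Fin n, (0 : E →L[ℝ] ℝ)) y :=
    HasFDerivAt.fun_sum fun k _ => HasFDerivAt.fun_sum fun i _ =>
      S.hasFDerivAt_productSurr_sub k c₀ ha _ _ _ (hw k i) (hp i)
  have h2 : DifferentiableAt ℝ (fun z => ∑ k, ∑ i, c₀ * (a (w k i z) * S.distSq k (p i z))) y := by
    unfold distSq
    fun_prop
  have h := h1.add h2.hasFDerivAt
  simp only [Finset.sum_const_zero, zero_add] at h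
  refine h.congr_of_eventuallyEq (Eventually.of_forall fun z => ?_)
  simp [Finset.sum_sub_distrib]

/-- A decrease of the partial linearization is inherited by the product for short steps. -/
theorem product_step_le (k : Fin K) {c₀ M R τ₀ τ τx τy L Lv t : ℝ} {a : ℝ → ℝ} {p pv : Plane}
    (hc₀ : 0 ≤ c₀) (ha : a (Lv + t * (L - Lv)) ≤ a Lv + t * (a L - a Lv)) (haL : 0 ≤ a L)
    (haLv : 0 ≤ a Lv) (hM : |a L - a Lv| ≤ M * |L - Lv|)
    (hR : |S.distSq k p - S.distSq k pv| ≤ R * (|p 0 - pv 0| + |p 1 - pv 1|))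
    (hM0 : 0 ≤ M) (hR0 : 0 ≤ R) (hτ₀ : 0 < τ₀)
    (hτ : τ₀ ≤ τ) (hτx : τ₀ ≤ τx) (hτy : τ₀ ≤ τy) (ht : 0 ≤ t) (ht1 : t ≤ 1)
    (htC : t * (2 * c₀ * M * R / τ₀) ≤ 1) :
    c₀ * (a (Lv + t * (L - Lv)) * S.distSq k (pv + t • (p - pv))) ≤
      c₀ * (a Lv * S.distSq k pv) + t * (S.productSurr k c₀ a τ τx τy L p Lv pv -
        S.productSurr k c₀ a τ τx τy Lv pv Lv pv) := by
  have hd : S.distSq k (pv + t • (p - pv)) ≤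
      S.distSq k pv + t * (S.distSq k p - S.distSq k pv) := by
    have h := (S.convexOn_distSq k).2 (Set.mem_univ pv) (Set.mem_univ p) (sub_nonneg.2 ht1) ht
      (by ring)
    have e : pv + t • (p - pv) = (1 - t) • pv + t • p := by
      rw [smul_sub, sub_smul, one_smul]; abel
    rw [e]
    simp only [smul_eq_mul] at h
    linarith
  have ha0 : 0 ≤ a Lv + t * (a L - a Lv) := by
    have h1 := mul_nonneg ht haL
    have h2 := mul_nonneg (sub_nonneg.2 ht1) haLv
    linarith
  have h1 := mul_le_mul ha hd (S.distSq_pos k _).le ha0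
  -- Expanding the product along the step leaves one term of order `t ^ 2`, the product of
  -- increments. The Lipschitz bounds turn it into squared distances that the proximal terms can
  -- absorb.
  have hprod : (a L - a Lv) * (S.distSq k p - S.distSq k pv) ≤
      M * R * ((L - Lv) ^ 2 + (p 0 - pv 0) ^ 2 + (p 1 - pv 1) ^ 2) := by
    have h2 := (le_abs_self _).trans_eq (abs_mul (a L - a Lv) (S.distSq k p - S.distSq k pv))
    have h3 := h2.trans (mul_le_mul hM hR (abs_nonneg _) (by positivity))
    have h4 : |L - Lv| * (|p 0 - pv 0| + |p 1 - pv 1|) ≤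
        (L - Lv) ^ 2 + (p 0 - pv 0) ^ 2 + (p 1 - pv 1) ^ 2 := by
      rw [← sq_abs (L - Lv), ← sq_abs (p 0 - pv 0), ← sq_abs (p 1 - pv 1)]
      linarith [two_mul_le_add_sq |L - Lv| |p 0 - pv 0|, two_mul_le_add_sq |L - Lv| |p 1 - pv 1|,
        sq_nonneg |p 0 - pv 0|, sq_nonneg |p 1 - pv 1|]
    have h5 := mul_le_mul_of_nonneg_left h4 (mul_nonneg hM0 hR0)
    linarith
  -- This is the reason for the constant `2 * c₀ * M * R / τ₀`: it makes the cross term at most `τ₀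
  -- / 2` times the squared distances.
  have htc : t * c₀ * (M * R) ≤ τ₀ / 2 := by
    rw [← mul_div_assoc, div_le_one hτ₀] at htC
    linarith
  have hprox : t * c₀ * ((a L - a Lv) * (S.distSq k p - S.distSq k pv)) ≤
      τ / 2 * (L - Lv) ^ 2 + τx / 2 * (p 0 - pv 0) ^ 2 + τy / 2 * (p 1 - pv 1) ^ 2 := by
    have h2 := mul_le_mul_of_nonneg_left hprod (mul_nonneg ht hc₀)
    have h3 := mul_le_mul_of_nonneg_right (show t * c₀ * (M * R) ≤ τ / 2 by linarith)
      (sq_nonneg (L - Lv))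
    have h4 := mul_le_mul_of_nonneg_right (show t * c₀ * (M * R) ≤ τx / 2 by linarith)
      (sq_nonneg (p 0 - pv 0))
    have h5 := mul_le_mul_of_nonneg_right (show t * c₀ * (M * R) ≤ τy / 2 by linarith)
      (sq_nonneg (p 1 - pv 1))
    linarith
  refine (mul_le_mul_of_nonneg_left h1 hc₀).trans ?_
  have h6 := mul_le_mul_of_nonneg_left hprox ht
  rw [productSurr_self]
  unfold productSurr
  linarith

end Params

theorem sum_sum_le_add_mul {ι κ : Type*} [Fintype ι] [Fintype κ] {F G H₁ H₂ : ι → κ → ℝ} {t : ℝ}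
    (h : ∀ k i, F k i ≤ G k i + t * (H₁ k i - H₂ k i)) :
    ∑ k, ∑ i, F k i ≤ ∑ k, ∑ i, G k i + t * (∑ k, ∑ i, H₁ k i - ∑ k, ∑ i, H₂ k i) := by
  refine (Finset.sum_le_sum fun k _ => Finset.sum_le_sum fun i _ => h k i).trans_eq ?_
  simp only [Finset.sum_add_distrib, ← Finset.mul_sum, Finset.sum_sub_distrib]

/-! ## The schedules -/

section Schedules

variable {K N : ℕ} (S : Params K)

theorem velocity_combination (x y : OVar K N) (a b : ℝ) (n : Fin N) :
    velocity S (a • x + b • y) n = a • velocity S x n + b • velocity S y n := by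
  have e : ∀ j, (a • x + b • y).path j = a • x.path j + b • y.path j := fun _ => rfl
  simp only [velocity, e]
  module

theorem convex_schedules : Convex ℝ (schedules S N) := by
  rintro x ⟨x1, x2, x3, x4, x5, x6, x7, x8, x9⟩ y ⟨y1, y2, y3, y4, y5, y6, y7, y8, y9⟩ a b ha hb hab
  have e1 : ∀ k i, (a • x + b • y).up k i = a * x.up k i + b * y.up k i := fun _ _ => rfl
  have e2 : ∀ k i, (a • x + b • y).comp k i = a * x.comp k i + b * y.comp k i := fun _ _ => rfl
  have e3 : ∀ k i, (a • x + b • y).down k i = a * x.down k i + b * y.down k i := fun _ _ => rfl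
  have e4 : ∀ j, (a • x + b • y).path j = a • x.path j + b • y.path j := fun _ => rfl
  refine ⟨fun k n => ?_, fun k n => ?_, fun k => ?_, fun k => ?_, fun k => ?_,
    fun k i => ⟨?_, ?_, ?_⟩, ?_, ?_, fun n => ?_⟩
  · simp only [e1, e2, Finset.sum_add_distrib, ← Finset.mul_sum]
    exact add_le_add (mul_le_mul_of_nonneg_left (x1 k n) ha)
      (mul_le_mul_of_nonneg_left (y1 k n) hb)
  · simp only [e3, e2, Finset.sum_add_distrib, ← Finset.mul_sum]
    refine (add_le_add (mul_le_mul_of_nonneg_left (x2 k n) ha)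
      (mul_le_mul_of_nonneg_left (y2 k n) hb)).trans_eq ?_
    ring
  · simp only [e1, Finset.sum_add_distrib, ← Finset.mul_sum, x3, y3]
    rw [← add_mul, hab, one_mul]
  · simp only [e2, Finset.sum_add_distrib, ← Finset.mul_sum, x4, y4]
    rw [← add_mul, hab, one_mul]
  · simp only [e3, Finset.sum_add_distrib, ← Finset.mul_sum, x5, y5]
    rw [← add_mul, hab, one_mul]
  · exact add_nonneg (mul_nonneg ha (x6 k i).1) (mul_nonneg hb (y6 k i).1)
  · exact add_nonneg (mul_nonneg ha (x6 k i).2.1) (mul_nonneg hb (y6 k i).2.1)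
  · exact add_nonneg (mul_nonneg ha (x6 k i).2.2) (mul_nonneg hb (y6 k i).2.2)
  · rw [e4, x7, y7, ← add_smul, hab, one_smul]
  · rw [e4, x8, y8, ← add_smul, hab, one_smul]
  · rw [velocity_combination]
    have h := (convexOn_norm (E := Plane) convex_univ).2 (Set.mem_univ (velocity S x n))
      (Set.mem_univ (velocity S y n)) ha hb hab
    refine h.trans ((add_le_add (mul_le_mul_of_nonneg_left (x9 n) ha)
      (mul_le_mul_of_nonneg_left (y9 n) hb)).trans_eq ?_)
    rw [← add_mul, hab, one_mul]

theorem isClosed_schedules : IsClosed (schedules S N) := by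
  simp only [schedules, velocity, Set.ofPred_and, Set.ofPred_forall]
  refine .inter ?_ (.inter ?_ (.inter ?_ (.inter ?_ (.inter ?_ (.inter ?_ (.inter ?_
    (.inter ?_ ?_)))))))
  · exact isClosed_iInter fun k => isClosed_iInter fun n => isClosed_le (by fun_prop) (by fun_prop)
  · exact isClosed_iInter fun k => isClosed_iInter fun n => isClosed_le (by fun_prop) (by fun_prop)
  · exact isClosed_iInter fun k => isClosed_eq (by fun_prop) (by fun_prop)
  · exact isClosed_iInter fun k => isClosed_eq (by fun_prop) (by fun_prop)
  · exact isClosed_iInter fun k => isClosed_eq (by fun_prop) (by fun_prop)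
  · exact isClosed_iInter fun k => isClosed_iInter fun i =>
      (isClosed_le (by fun_prop) (by fun_prop)).inter
        ((isClosed_le (by fun_prop) (by fun_prop)).inter (isClosed_le (by fun_prop) (by fun_prop)))
  · exact isClosed_eq (by fun_prop) (by fun_prop)
  · exact isClosed_eq (by fun_prop) (by fun_prop)
  · exact isClosed_iInter fun n => isClosed_le (by fun_prop) (by fun_prop)

theorem norm_alloc_le {x : Alloc K N} {D : ℝ} (hD : 0 ≤ D) (hx : ∀ k i, 0 ≤ x k i ∧ x k i ≤ D) :
    ‖x‖ ≤ D := by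
  refine (pi_norm_le_iff_of_nonneg hD).2 fun k => (pi_norm_le_iff_of_nonneg hD).2 fun i => ?_
  rw [Real.norm_of_nonneg (hx k i).1]
  exact (hx k i).2

/-- Each frame moves the UAV by at most `Δ * vmax` from the prescribed starting point. -/
theorem norm_path_le {z : OVar K N} (hz : z ∈ schedules S N) (j : Fin (N + 1)) :
    ‖z.path j‖ ≤ ‖S.pI‖ + j * (S.Δ * S.vmax) := by
  obtain ⟨-, -, -, -, -, -, h0, -, hv⟩ := hz
  induction j using Fin.induction with
  | zero => simp [h0]
  | succ j ih =>
    have h1 : z.path j.succ = z.path j.castSucc + S.Δ • velocity S z j := by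
      rw [velocity, smul_smul, mul_one_div_cancel S.Δ_pos.ne', one_smul, add_sub_cancel]
    have h2 : ‖S.Δ • velocity S z j‖ ≤ S.Δ * S.vmax := by
      rw [norm_smul, Real.norm_of_nonneg S.Δ_pos.le]
      exact mul_le_mul_of_nonneg_left (hv j) S.Δ_pos.le
    rw [h1]
    refine (norm_add_le _ _).trans ((add_le_add ih h2).trans_eq ?_)
    simp only [Fin.val_castSucc, Fin.val_succ]
    push_cast
    ring

theorem exists_norm_le_of_mem_schedules :
    ∃ D, 0 ≤ D ∧ ∀ z ∈ schedules S N, ‖z‖ ≤ D := by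
  have hO : ∀ k, 0 ≤ S.O k * S.I k := fun k => mul_nonneg (S.O_nonneg k) (S.I_nonneg k)
  have hΔ : 0 ≤ S.Δ * S.vmax := mul_nonneg S.Δ_pos.le S.vmax_nonneg
  let D₁ := ∑ k, S.I k
  let D₂ := ∑ k, S.O k * S.I k
  let D₃ := ‖S.pI‖ + N * (S.Δ * S.vmax)
  have h₁ : 0 ≤ D₁ := Finset.sum_nonneg fun k _ => S.I_nonneg k
  have h₂ : 0 ≤ D₂ := Finset.sum_nonneg fun k _ => hO k
  have h₃ : 0 ≤ D₃ := by positivity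
  refine ⟨D₁ + D₂ + D₃, by positivity, fun z hz => ?_⟩
  have hpath := norm_path_le S hz
  obtain ⟨-, -, hup, hcomp, hdown, hnn, -⟩ := hz
  have hI : ∀ k, S.I k ≤ D₁ := fun k =>
    Finset.single_le_sum (fun k _ => S.I_nonneg k) (Finset.mem_univ k)
  have hOI : ∀ k, S.O k * S.I k ≤ D₂ := fun k =>
    Finset.single_le_sum (f := fun k => S.O k * S.I k) (fun k _ => hO k) (Finset.mem_univ k)
  have b1 : ‖z.up‖ ≤ D₁ := norm_alloc_le h₁ fun k i => ⟨(hnn k i).1,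
    (Finset.single_le_sum (fun i _ => (hnn k i).1) (Finset.mem_univ i)).trans
      ((hup k).trans_le (hI k))⟩
  have b2 : ‖z.comp‖ ≤ D₁ := norm_alloc_le h₁ fun k i => ⟨(hnn k i).2.1,
    (Finset.single_le_sum (fun i _ => (hnn k i).2.1) (Finset.mem_univ i)).trans
      ((hcomp k).trans_le (hI k))⟩
  have b3 : ‖z.down‖ ≤ D₂ := norm_alloc_le h₂ fun k i => ⟨(hnn k i).2.2,
    (Finset.single_le_sum (fun i _ => (hnn k i).2.2) (Finset.mem_univ i)).trans
      ((hdown k).trans_le (hOI k))⟩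
  have b4 : ‖z.path‖ ≤ D₃ := (pi_norm_le_iff_of_nonneg h₃).2 fun j => (hpath j).trans (by
    have : (j : ℝ) ≤ N := by exact_mod_cast Nat.lt_succ_iff.1 j.2
    exact add_le_add_right (mul_le_mul_of_nonneg_right this hΔ) _)
  simp only [Prod.norm_def, max_le_iff]
  exact ⟨by linarith, by linarith, by linarith, by linarith⟩

theorem totalFly_nonneg (z : OVar K N) : 0 ≤ totalFly S z := by
  have := S.mass_pos
  have := S.Δ_pos
  unfold totalFly Params.flyEnergy
  positivity

theorem contDiff_totalFly : ContDiff ℝ 1 (totalFly S (N := N)) := by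
  unfold totalFly velocity Params.flyEnergy
  -- The norm is not differentiable at zero; its square is a polynomial in the coordinates.
  simp only [EuclideanSpace.norm_sq_eq, Real.norm_eq_abs, sq_abs]
  fun_prop

theorem convexOn_totalFly {E : Type*} [AddCommGroup E] [Module ℝ E] {s : Set E} (hs : Convex ℝ s)
    {g : E → OVar K N} (hg : ∀ x y : E, ∀ a b : ℝ, g (a • x + b • y) = a • g x + b • g y) :
    ConvexOn ℝ s fun x => totalFly S (g x) := by
  have := S.mass_pos
  have := S.Δ_pos
  refine ConvexOn.finset_sum hs _ fun n _ => ?_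
  refine ((convexOn_norm convex_univ).comp_of_map_combination hs (fun x y a b => ?_)
    fun _ _ => trivial).const_mul_sq (by positivity) fun _ _ => norm_nonneg _
  rw [hg, velocity_combination]

end Schedules

end UAV

namespace UAV

section Problems

variable {K N : ℕ} (S : Params K)

theorem abs_up_le (z : OVar K N) (k : Fin K) (i : Fin (N - 2)) : |z.up k i| ≤ ‖z‖ :=
  ((norm_le_pi_norm (z.up k) i).trans (norm_le_pi_norm z.up k)).trans (norm_fst_le z)

theorem norm_path_apply_le (z : OVar K N) (j : Fin (N + 1)) : ‖z.path j‖ ≤ ‖z‖ :=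
  (norm_le_pi_norm z.path j).trans
    ((norm_snd_le z.2.2).trans ((norm_snd_le z.2).trans (norm_snd_le z)))

theorem exists_tau_le {n : ℕ} {τ : Fin K → Fin n → ℝ} {τx τy : Fin n → ℝ} (hτ : ∀ k i, 0 < τ k i)
    (hτx : ∀ i, 0 < τx i) (hτy : ∀ i, 0 < τy i) :
    ∃ τ₀ > 0, (∀ k i, τ₀ ≤ τ k i) ∧ (∀ i, τ₀ ≤ τx i) ∧ ∀ i, τ₀ ≤ τy i := by
  obtain ⟨c₁, h₁, h₁'⟩ := exists_pos_forall_le (f := fun q : Fin K × Fin n => τ q.1 q.2)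
    fun q => hτ q.1 q.2
  obtain ⟨c₂, h₂, h₂'⟩ := exists_pos_forall_le hτx
  obtain ⟨c₃, h₃, h₃'⟩ := exists_pos_forall_le hτy
  exact ⟨min c₁ (min c₂ c₃), lt_min h₁ (lt_min h₂ h₃),
    fun k i => (min_le_left _ _).trans (h₁' (k, i)),
    fun i => (min_le_right _ _).trans ((min_le_left _ _).trans (h₂' i)),
    fun i => (min_le_right _ _).trans ((min_le_right _ _).trans (h₃' i))⟩

/-- The squared distance to every user is Lipschitz along bounded trajectories. -/
theorem abs_distSq_sub_le_sum (k : Fin K) {D : ℝ} {p pv : Plane} (hp : ‖p‖ ≤ D)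
    (hpv : ‖pv‖ ≤ D) : |S.distSq k p - S.distSq k pv| ≤
      (2 * D + 2 * ∑ k, ‖S.pos k‖) * (|p 0 - pv 0| + |p 1 - pv 1|) := by
  refine (S.abs_distSq_sub_le k hp hpv).trans (mul_le_mul_of_nonneg_right ?_ (by positivity))
  have := Finset.single_le_sum (f := fun k => ‖S.pos k‖) (fun k _ => norm_nonneg _)
    (Finset.mem_univ k)
  linarith

/-! ### Orthogonal access: verification of the inner approximation -/

theorem orthProblem_obj (z : OVar K N) : (orthProblem S N).obj z =
    ∑ k, ∑ i, S.noise / K / S.g₀ * (S.oRate (z.up k i) * S.distSq k (z.pUp i)) := by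
  simp only [orthProblem, S.oEnergy_eq]

theorem orthApprox_obj (τL : Alloc K N) (τx τy : Fin (N - 2) → ℝ) (y z : OVar K N) :
    (orthApprox S τL τx τy y).obj z = ∑ k, ∑ i, S.productSurr k (S.noise / K / S.g₀) S.oRate
      (τL k i) (τx i) (τy i) (z.up k i) (z.pUp i) (y.up k i) (y.pUp i) := by
  simp only [orthApprox, S.oUpSurr_eq]

theorem orthApprox_isInnerApprox (τL : Alloc K N) (τx τy : Fin (N - 2) → ℝ)
    (hτL : ∀ k i, 0 < τL k i) (hτx : ∀ i, 0 < τx i) (hτy : ∀ i, 0 < τy i) :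
    (orthProblem S N).IsInnerApprox (orthApprox S τL τx τy) where
  convex_carrier := convex_schedules S
  isClosed_carrier := isClosed_schedules S
  carrier_eq _ := rfl
  contDiff_obj := by
    have : (orthProblem S N).obj = _ := funext (orthProblem_obj S)
    rw [this]
    simp only [Params.oRate, Params.distSq, OVar.pUp, Real.rpow_def_of_pos two_pos]
    fun_prop
  contDiff_con _ := by
    have := contDiff_totalFly S (N := N)
    simp only [orthProblem, S.oEnergy_eq, S.compEnergy_eq, Params.load, Params.oRate,
      Params.distSq, OVar.pDown, Real.rpow_def_of_pos two_pos]
    fun_prop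
  contDiff_approx_obj := by
    simp only [orthApprox, Params.oUpSurr, Params.oRate, Params.distSq, OVar.pUp,
      Real.rpow_def_of_pos two_pos]
    fun_prop
  contDiff_approx_con _ := by
    have := contDiff_totalFly S (N := N)
    simp only [orthApprox, Params.compSurr, Params.oDownSurr, Params.oRate,
      Params.distSq, OVar.pDown, Real.rpow_def_of_pos two_pos]
    fun_prop
  convex_con y hy _ := by
    have hs := convex_schedules S (N := N)
    refine ((ConvexOn.finset_sum hs _ fun k _ => ConvexOn.finset_sum hs _ fun i _ =>
      ConvexOn.add ?_ ?_).add (convexOn_totalFly S hs (g := id) fun _ _ _ _ => rfl)).add_const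
        (-S.budget)
    · exact (S.convexOn_compSurr k _).comp_of_map_combination hs
        (g := fun z : OVar K N => fun k' => z.comp k' i) (fun _ _ _ _ => rfl)
        fun z hz => (hz.2.2.2.2.2.1 k i).2.1
    · exact (S.convexOn_oDownSurr k _ _).comp_of_map_combination hs
        (g := fun z : OVar K N => (z.down k i, z.pDown i)) (fun _ _ _ _ => rfl)
        fun z hz => ⟨(hz.2.2.2.2.2.1 k i).2.2, trivial⟩
  con_self y _ := by
    simp only [orthApprox, orthProblem, S.compSurr_self, S.oDownSurr_self]
  con_le y hy _ x := by
    refine sub_le_sub_right (add_le_add_left (Finset.sum_le_sum fun k _ =>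
      Finset.sum_le_sum fun i _ => ?_) _) _
    have hnn := hy.1.2.2.2.2.2.1 k i
    exact add_le_add (S.compEnergy_le_compSurr k _ hnn.2.1)
      (S.oEnergy_le_oDownSurr k _ _ _ hnn.2.2)
  hasFDerivAt_obj y := by
    have h1 : (orthProblem S N).obj = _ := funext (orthProblem_obj S)
    have h2 : (orthApprox S τL τx τy y).obj = _ := funext (orthApprox_obj S τL τx τy y)
    rw [h1, h2]
    exact S.hasFDerivAt_sum_productSurr _ ((contDiff_rate _).differentiable one_ne_zero) τL τx τy
      (w := fun k i (z : OVar K N) => z.up k i) (p := fun i (z : OVar K N) => z.pUp i)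
      (fun k i => by fun_prop) fun i => by unfold OVar.pUp; fun_prop
  obj_nonneg y hy := by
    rw [orthProblem_obj]
    exact Finset.sum_nonneg fun k _ => Finset.sum_nonneg fun i _ => mul_nonneg S.oCoeff_nonneg
      (mul_nonneg (S.oRate_nonneg (hy.1.2.2.2.2.2.1 k i).1) (S.distSq_pos _ _).le)
  descent := by
    obtain ⟨D, hD0, hD⟩ := exists_norm_le_of_mem_schedules S (N := N)
    obtain ⟨τ₀, hτ₀, h1, h2, h3⟩ := exists_tau_le hτL hτx hτy
    -- The threshold of `product_step_le`, with the Lipschitz constants of the rate and of the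
    -- squared distance on the bounded set of schedules.
    refine ⟨2 * (S.noise / K / S.g₀) * (Real.log 2 / (S.B * S.Δ / K) *
      (2 : ℝ) ^ (D / (S.B * S.Δ / K))) * (2 * D + 2 * ∑ k, ‖S.pos k‖) / τ₀,
      fun y hy x hx t ht ht1 htC => ?_⟩
    simp only [orthProblem_obj, orthApprox_obj]
    refine sum_sum_le_add_mul fun k i => ?_
    have hxn := (hx.2.2.2.2.2.1 k i).1
    have hyn := (hy.1.2.2.2.2.2.1 k i).1
    have hxD := (abs_le.1 ((abs_up_le x k i).trans (hD x hx))).2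
    have hyD := (abs_le.1 ((abs_up_le y k i).trans (hD y hy.1))).2
    have hconv := (convexOn_rate (S.B * S.Δ / K)).2 (Set.mem_univ (y.up k i))
      (Set.mem_univ (x.up k i)) (sub_nonneg.2 ht1) ht (by ring)
    have hlog := Real.log_nonneg one_le_two
    have hw := S.oWidth_nonneg
    refine S.product_step_le k S.oCoeff_nonneg ?_ (S.oRate_nonneg hxn) (S.oRate_nonneg hyn)
      (abs_rate_sub_le S.oWidth_nonneg hxD hyD)
      (abs_distSq_sub_le_sum S k ((norm_path_apply_le x _).trans (hD x hx))
        ((norm_path_apply_le y _).trans (hD y hy.1)))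
      (by positivity) (by positivity) hτ₀ (h1 k i) (h2 i) (h3 i) ht ht1 htC
    simp only [smul_eq_mul] at hconv
    rw [S.oRate_eq, S.oRate_eq, S.oRate_eq,
      show y.up k i + t * (x.up k i - y.up k i) = (1 - t) * y.up k i + t * x.up k i by ring]
    linarith
  bounded R := by
    obtain ⟨D, -, hD⟩ := exists_norm_le_of_mem_schedules S (N := N)
    exact ⟨D, fun _ _ _ x hx _ => hD x hx.1⟩

/-! ### Non-orthogonal access: verification of the inner approximation -/

theorem nomaProblem_obj (z : NVar K N) : (nomaProblem S N).obj z =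
    ∑ k, ∑ i, 1 / S.g₀ * (id (z.2.1 k i) * S.distSq k (z.1.pUp i)) := by
  simp only [nomaProblem, S.div_gain_eq]

theorem nomaApprox_obj (τα : Alloc K N) (τx τy : Fin (N - 2) → ℝ) (y z : NVar K N) :
    (nomaApprox S τα τx τy y).obj z = ∑ k, ∑ i, S.productSurr k (1 / S.g₀) id
      (τα k i) (τx i) (τy i) (z.2.1 k i) (z.1.pUp i) (y.2.1 k i) (y.1.pUp i) := by
  simp only [nomaApprox, S.nObjSurr_eq]

theorem convex_slackSchedules : Convex ℝ (slackSchedules S N) :=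
  fun _ hx _ hy _ _ ha hb hab => ⟨convex_schedules S hx.1 hy.1 ha hb hab, fun k i =>
    ⟨add_nonneg (mul_nonneg ha (hx.2 k i).1) (mul_nonneg hb (hy.2 k i).1),
      add_nonneg (mul_nonneg ha (hx.2 k i).2) (mul_nonneg hb (hy.2 k i).2)⟩⟩

theorem isClosed_slackSchedules : IsClosed (slackSchedules S N) := by
  simp only [slackSchedules, Set.ofPred_and, Set.ofPred_forall]
  exact ((isClosed_schedules S).preimage continuous_fst).inter
    (isClosed_iInter fun k => isClosed_iInter fun i =>
      (isClosed_le (by fun_prop) (by fun_prop)).inter (isClosed_le (by fun_prop) (by fun_prop)))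

theorem nomaProblem_con_le_nomaApprox_con (τα : Alloc K N) (τx τy : Fin (N - 2) → ℝ)
    {y : NVar K N} (hy : y ∈ slackSchedules S N) (j : NCon K N) (x : NVar K N) :
    (nomaProblem S N).con j x ≤ (nomaApprox S τα τx τy y).con j x := by
  have hnn := hy.1.2.2.2.2.2.1
  rcases j with _ | ⟨k, i⟩ | ⟨k, i⟩
  · exact sub_le_sub_right (add_le_add_left (Finset.sum_le_sum fun k _ =>
      Finset.sum_le_sum fun i _ => add_le_add_left
        (S.compEnergy_le_compSurr k _ (hnn k i).2.1) _) _) _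
  · exact sub_le_sub_right (S.nUpEnergy_le_nUpSurr k _ _ _ (hnn k i).1 fun k' => (hy.2 k' i).1) _
  · exact sub_le_sub_right
      (S.nDownEnergy_le_nDownSurr k _ _ _ _ (hnn k i).2.2 fun k' => (hy.2 k' i).2) _

theorem nomaApprox_convexOn_con (τα : Alloc K N) (τx τy : Fin (N - 2) → ℝ) (y : NVar K N)
    (j : NCon K N) : ConvexOn ℝ (slackSchedules S N) ((nomaApprox S τα τx τy y).con j) := by
  have hs := convex_slackSchedules S (N := N)
  have hlin : ∀ g : NVar K N → ℝ, (∀ x y : NVar K N, ∀ a b : ℝ, g (a • x + b • y) =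
      a • g x + b • g y) → ConvexOn ℝ (slackSchedules S N) g := fun g hg =>
    (convexOn_id convex_univ).comp_of_map_combination hs hg fun _ _ => trivial
  have hneg : ∀ (u v : ℝ) (a b : ℝ), -(a * u + b * v) = a * -u + b * -v := fun _ _ _ _ => by ring
  rcases j with _ | ⟨k, i⟩ | ⟨k, i⟩
  · refine ((ConvexOn.finset_sum hs _ fun k _ => ConvexOn.finset_sum hs _ fun i _ =>
      ConvexOn.add ?_ (hlin (fun z => z.2.2 k i) fun _ _ _ _ => rfl)).add
      (convexOn_totalFly S hs (g := Prod.fst) fun _ _ _ _ => rfl)).add_const (-S.budget)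
    exact (S.convexOn_compSurr k _).comp_of_map_combination hs
      (g := fun z : NVar K N => fun k' => z.1.comp k' i) (fun _ _ _ _ => rfl)
      fun z hz => (hz.1.2.2.2.2.2.1 k i).2.1
  · refine ConvexOn.add ?_ (hlin (fun z => -z.2.1 k i) fun _ _ _ _ => hneg _ _ _ _)
    exact (S.convexOn_nUpSurr k _ _).comp_of_map_combination hs
      (g := fun z : NVar K N => (z.1.up k i, fun k' => z.2.1 k' i)) (fun _ _ _ _ => rfl)
      fun z hz => ⟨(hz.1.2.2.2.2.2.1 k i).1, fun k' => (hz.2 k' i).1⟩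
  · refine ConvexOn.add ?_ (hlin (fun z => -z.2.2 k i) fun _ _ _ _ => hneg _ _ _ _)
    exact (S.convexOn_nDownSurr k _ _ _).comp_of_map_combination hs
      (g := fun z : NVar K N => (z.1.down k i, z.1.pDown i, fun k' => z.2.2 k' i))
      (fun _ _ _ _ => rfl)
      fun z hz => ⟨(hz.1.2.2.2.2.2.1 k i).2.2, trivial, fun k' => (hz.2 k' i).2⟩

theorem contDiff_nomaProblem_con (j : NCon K N) : ContDiff ℝ 1 ((nomaProblem S N).con j) := by
  have := contDiff_totalFly S (N := N)
  rcases j with _ | ⟨k, i⟩ | ⟨k, i⟩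
  · simp only [nomaProblem, S.compEnergy_eq, Params.load]
    fun_prop
  · simp only [nomaProblem, S.gain_mul_nUpEnergy, Params.nRate, Params.others,
      Real.rpow_def_of_pos two_pos]
    fun_prop
  · simp only [nomaProblem, S.nDownEnergy_eq, Params.nRate, Params.others, Params.distSq,
      OVar.pDown, Real.rpow_def_of_pos two_pos]
    fun_prop

set_option synthInstance.maxSize 512 in
theorem contDiff_nomaApprox_con (τα : Alloc K N) (τx τy : Fin (N - 2) → ℝ) (j : NCon K N) :
    ContDiff ℝ 1 fun q : NVar K N × NVar K N => (nomaApprox S τα τx τy q.1).con j q.2 := by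
  have := contDiff_totalFly S (N := N)
  rcases j with _ | ⟨k, i⟩ | ⟨k, i⟩
  · simp only [nomaApprox, Params.compSurr]
    fun_prop
  · simp only [nomaApprox, Params.nUpSurr, Params.nRate, Real.rpow_def_of_pos two_pos]
    fun_prop
  · simp only [nomaApprox, Params.nDownSurr, Params.nRate, Params.distSq, OVar.pDown,
      Real.rpow_def_of_pos two_pos]
    fun_prop

/-- The altitude keeps the squared distance at least `H ^ 2`, so the surrogate objective controls
the uplink slack `α`, which the schedules leave unbounded. -/
theorem le_productSurr (k : Fin K) {τ τx τy α αv : ℝ} (p pv : Plane) (hτ : 0 ≤ τ) (hτx : 0 ≤ τx)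
    (hτy : 0 ≤ τy) (hα : 0 ≤ α) (hαv : 0 ≤ αv) :
    1 / S.g₀ * (α * S.H ^ 2) ≤ S.productSurr k (1 / S.g₀) id τ τx τy α p αv pv := by
  have hg := S.g₀_pos
  have h1 := mul_le_mul_of_nonneg_left (S.distSq_ge k pv) hα
  have h2 := mul_nonneg hαv (S.distSq_pos k p).le
  have h3 : 1 / S.g₀ * (α * S.H ^ 2) ≤
      1 / S.g₀ * (α * S.distSq k pv + αv * S.distSq k p) := by
    gcongr
    linarith
  have h4 : 0 ≤ τ / 2 * (α - αv) ^ 2 + τx / 2 * (p 0 - pv 0) ^ 2 + τy / 2 * (p 1 - pv 1) ^ 2 := by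
    positivity
  simp only [Params.productSurr, id]
  linarith

theorem nomaApprox_bounded (τα : Alloc K N) (τx τy : Fin (N - 2) → ℝ)
    (hτα : ∀ k i, 0 < τα k i) (hτx : ∀ i, 0 < τx i) (hτy : ∀ i, 0 < τy i) (R : ℝ) :
    ∃ D : ℝ, ∀ y ∈ (nomaProblem S N).feasible, (nomaProblem S N).obj y ≤ R →
      ∀ x ∈ (nomaApprox S τα τx τy y).feasible,
        (nomaApprox S τα τx τy y).obj x ≤ (nomaApprox S τα τx τy y).obj y → ‖x‖ ≤ D := by
  obtain ⟨D, hD0, hD⟩ := exists_norm_le_of_mem_schedules S (N := N)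
  have hc : 0 < 1 / S.g₀ * S.H ^ 2 := mul_pos (one_div_pos.2 S.g₀_pos) (pow_pos S.H_pos 2)
  have hb0 : 0 ≤ 2 * |R| / (1 / S.g₀ * S.H ^ 2) := by positivity
  -- `D` bounds the schedule. The second entry bounds `α`, its factor 2 being the doubling of the
  -- product in the surrogate at its base point. The budget bounds `β`, since all energies are
  -- nonnegative.
  refine ⟨max D (max (2 * |R| / (1 / S.g₀ * S.H ^ 2)) |S.budget|),
    fun y hy hyR x hx hxy => ?_⟩
  have hα : ∀ k i, x.2.1 k i ≤ 2 * |R| / (1 / S.g₀ * S.H ^ 2) := by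
    intro k i
    have hterm : ∀ k i, 1 / S.g₀ * (x.2.1 k i * S.H ^ 2) ≤ S.productSurr k (1 / S.g₀) id
        (τα k i) (τx i) (τy i) (x.2.1 k i) (x.1.pUp i) (y.2.1 k i) (y.1.pUp i) := fun k i =>
      le_productSurr S k _ _ (hτα k i).le (hτx i).le (hτy i).le (hx.1.2 k i).1 (hy.1.2 k i).1
    have hnn : ∀ k i, 0 ≤ 1 / S.g₀ * (x.2.1 k i * S.H ^ 2) := fun k i =>
      mul_nonneg (one_div_pos.2 S.g₀_pos).le (mul_nonneg (hx.1.2 k i).1 (sq_nonneg _))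
    have h1 := (Finset.single_le_sum (fun i _ => hnn k i) (Finset.mem_univ i)).trans
      (Finset.single_le_sum (f := fun k => ∑ i, 1 / S.g₀ * (x.2.1 k i * S.H ^ 2))
        (fun k _ => Finset.sum_nonneg fun i _ => hnn k i) (Finset.mem_univ k))
    have h2 : ∑ k, ∑ i, 1 / S.g₀ * (x.2.1 k i * S.H ^ 2) ≤ (nomaApprox S τα τx τy y).obj x := by
      rw [nomaApprox_obj]
      exact Finset.sum_le_sum fun k _ => Finset.sum_le_sum fun i _ => hterm k i
    have h3 : (nomaApprox S τα τx τy y).obj y = 2 * (nomaProblem S N).obj y := by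
      simp only [nomaApprox_obj, nomaProblem_obj, S.productSurr_self, Finset.mul_sum]
    rw [le_div_iff₀ hc]
    linarith [le_abs_self R]
  have hβ : ∀ k i, x.2.2 k i ≤ |S.budget| := by
    intro k i
    have hcon : (∑ k, ∑ i, (S.compEnergy k (fun k' => x.1.comp k' i) + x.2.2 k i)) +
        totalFly S x.1 - S.budget ≤ 0 :=
      (nomaProblem_con_le_nomaApprox_con S τα τx τy hy.1 (.inl ()) x).trans (hx.2 (.inl ()))
    have hnn : ∀ k i, 0 ≤ S.compEnergy k (fun k' => x.1.comp k' i) + x.2.2 k i := fun k i =>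
      add_nonneg (S.compEnergy_nonneg k (hx.1.1.2.2.2.2.2.1 k i).2.1) (hx.1.2 k i).2
    have h1 := (Finset.single_le_sum (fun i _ => hnn k i) (Finset.mem_univ i)).trans
      (Finset.single_le_sum
        (f := fun k => ∑ i, (S.compEnergy k (fun k' => x.1.comp k' i) + x.2.2 k i))
        (fun k _ => Finset.sum_nonneg fun i _ => hnn k i) (Finset.mem_univ k))
    have h2 := S.compEnergy_nonneg k (l := fun k' => x.1.comp k' i)
      (hx.1.1.2.2.2.2.2.1 k i).2.1
    linarith [le_abs_self S.budget, totalFly_nonneg S x.1]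
  rw [Prod.norm_def x, Prod.norm_def x.2]
  exact max_le_max (hD _ hx.1.1) (max_le_max
    (norm_alloc_le hb0 fun k i => ⟨(hx.1.2 k i).1, hα k i⟩)
    (norm_alloc_le (abs_nonneg _) fun k i => ⟨(hx.1.2 k i).2, hβ k i⟩))

theorem nomaApprox_isInnerApprox (τα : Alloc K N) (τx τy : Fin (N - 2) → ℝ)
    (hτα : ∀ k i, 0 < τα k i) (hτx : ∀ i, 0 < τx i) (hτy : ∀ i, 0 < τy i) :
    (nomaProblem S N).IsInnerApprox (nomaApprox S τα τx τy) where
  convex_carrier := convex_slackSchedules S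
  isClosed_carrier := isClosed_slackSchedules S
  carrier_eq _ := rfl
  contDiff_obj := by
    have : (nomaProblem S N).obj = _ := funext (nomaProblem_obj S)
    rw [this]
    simp only [Params.distSq, OVar.pUp, id]
    fun_prop
  contDiff_con := contDiff_nomaProblem_con S
  contDiff_approx_obj := by
    simp only [nomaApprox, Params.nObjSurr, Params.distSq, OVar.pUp]
    fun_prop
  contDiff_approx_con := contDiff_nomaApprox_con S τα τx τy
  convex_con y _ := nomaApprox_convexOn_con S τα τx τy y
  con_self y j := by
    rcases j with _ | ⟨k, i⟩ | ⟨k, i⟩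
    · simp only [nomaApprox, nomaProblem, S.compSurr_self]
    · simp only [nomaApprox, nomaProblem, S.nUpSurr_self k _ (y.1.pUp i)]
    · simp only [nomaApprox, nomaProblem, S.nDownSurr_self]
  con_le _ hy := nomaProblem_con_le_nomaApprox_con S τα τx τy hy.1
  hasFDerivAt_obj y := by
    have h1 : (nomaProblem S N).obj = _ := funext (nomaProblem_obj S)
    have h2 : (nomaApprox S τα τx τy y).obj = _ := funext (nomaApprox_obj S τα τx τy y)
    rw [h1, h2]
    exact S.hasFDerivAt_sum_productSurr _ differentiable_id τα τx τy
      (w := fun k i (z : NVar K N) => z.2.1 k i) (p := fun i (z : NVar K N) => z.1.pUp i)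
      (fun k i => by fun_prop) fun i => by unfold OVar.pUp; fun_prop
  obj_nonneg y hy := by
    rw [nomaProblem_obj]
    exact Finset.sum_nonneg fun k _ => Finset.sum_nonneg fun i _ =>
      mul_nonneg (one_div_pos.2 S.g₀_pos).le
        (mul_nonneg (hy.1.2 k i).1 (S.distSq_pos _ _).le)
  descent := by
    obtain ⟨D, hD0, hD⟩ := exists_norm_le_of_mem_schedules S (N := N)
    obtain ⟨τ₀, hτ₀, h1, h2, h3⟩ := exists_tau_le hτα hτx hτy
    -- The factor `1` is the Lipschitz constant of the identity, which replaces the rate here, so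
    -- `α` need not be bounded.
    refine ⟨2 * (1 / S.g₀) * 1 * (2 * D + 2 * ∑ k, ‖S.pos k‖) / τ₀,
      fun y hy x hx t ht ht1 htC => ?_⟩
    simp only [nomaProblem_obj, nomaApprox_obj]
    exact sum_sum_le_add_mul fun k i =>
      S.product_step_le k (one_div_pos.2 S.g₀_pos).le le_rfl (hx.2 k i).1 (hy.1.2 k i).1
        (one_mul _).ge
        (abs_distSq_sub_le_sum S k ((norm_path_apply_le x.1 _).trans (hD x.1 hx.1))
          ((norm_path_apply_le y.1 _).trans (hD y.1 hy.1.1)))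
        zero_le_one (by positivity) hτ₀ (h1 k i) (h2 i) (h3 i) ht ht1 htC
  bounded := nomaApprox_bounded S τα τx τy hτα hτx hτy

end Problems

end UAV

theorem mainTheorem1 {K N : ℕ} (hK : 1 ≤ K) (hN : 3 ≤ N) (S : UAV.Params K)
    (τL τα : UAV.Alloc K N) (τx τy : Fin (N - 2) → ℝ)
    (hτL : ∀ k i, 0 < τL k i) (hτα : ∀ k i, 0 < τα k i)
    (hτx : ∀ i, 0 < τx i) (hτy : ∀ i, 0 < τy i)
    (γ : ℕ → ℝ) (hγ : ∀ v, 0 < γ v ∧ γ v ≤ 1) (hγ0 : Tendsto γ atTop (𝓝 0))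
    (hγsum : Tendsto (fun n => ∑ v ∈ Finset.range n, γ v) atTop atTop) :
    ((∀ y ∈ (UAV.orthProblem S N).feasible,
        ∃ zhat, (UAV.orthApprox S τL τx τy y).IsSolution zhat) ∧
      ∀ z : ℕ → UAV.OVar K N,
        (UAV.orthProblem S N).IsSCARun (UAV.orthApprox S τL τx τy) γ z →
          (∀ v, z v ∈ (UAV.orthProblem S N).feasible) ∧
          Bornology.IsBounded (Set.range z) ∧
          ∀ zlim, MapClusterPt zlim atTop z → (UAV.orthProblem S N).IsRegular zlim →
            (UAV.orthProblem S N).IsStationary zlim ∧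
            ((∀ v, ¬ (UAV.orthProblem S N).IsStationary (z v)) →
              ¬ IsLocalMaxOn (UAV.orthProblem S N).obj (UAV.orthProblem S N).feasible zlim)) ∧
    ((∀ y ∈ (UAV.nomaProblem S N).feasible,
        ∃ zhat, (UAV.nomaApprox S τα τx τy y).IsSolution zhat) ∧
      ∀ z : ℕ → UAV.NVar K N,
        (UAV.nomaProblem S N).IsSCARun (UAV.nomaApprox S τα τx τy) γ z →
          (∀ v, z v ∈ (UAV.nomaProblem S N).feasible) ∧
          Bornology.IsBounded (Set.range z) ∧
          ∀ zlim, MapClusterPt zlim atTop z → (UAV.nomaProblem S N).IsRegular zlim →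
            (UAV.nomaProblem S N).IsStationary zlim ∧
            ((∀ v, ¬ (UAV.nomaProblem S N).IsStationary (z v)) →
              ¬ IsLocalMaxOn (UAV.nomaProblem S N).obj (UAV.nomaProblem S N).feasible zlim)) := by

  exact ⟨(UAV.orthApprox_isInnerApprox S τL τx τy hτL hτx hτy).convergence hγ hγ0 hγsum,
    (UAV.nomaApprox_isInnerApprox S τα τx τy hτα hτx hτy).convergence hγ hγ0 hγsum⟩
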